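/- Let $\mathbb{QU}$ be the rational Urysohn metric space, i.e. the (up to isometry unique) countable metric space with only rational distances such that, whenever $Y=X\cup\{y\}$ is a one-point metric extension of a finite (possibly empty) metric space $X$ and all distances in $Y$ are rational, every isometric embedding $X\to\mathbb{QU}$ extends to an isometric embedding $Y\to\mathbb{QU}$. Let $G=\mathrm{Isom}(\mathbb{QU})$ be the group of isometries of $\mathbb{QU}$ onto itself with the permutation group topology, whose basic open sets are $\{g\in G : g(x)=f(x)\ \text{for all } x\in A\}$ with $f\in G$ and $A\subseteq\mathbb{QU}$ finite. Call $(g_1,\dots,g_n)\in G^n$ a generic commuting $n$-tuple if $g_ig_j=g_jg_i$ for all $i,j$ and its orbit $\{(kg_1k^{-1},\dots,kg_nk^{-1}) : k\in G\}$ is comeagre in the space of all commuting $n$-tuples, with the subspace topology from $G^n$. Then for every $n\ge 0$: 1. There is a generic commuting $n$-tuple in $G$. 2. For every generic commuting $n$-tuple $(g_1,\dots,g_n)$, let $C(g_1,\dots,g_n)$ be the centraliser of $\{g_1,\dots,g_n\}$ in $G$, with the subspace topology. The set of $f\in C(g_1,\dots,g_n)$ such that $(g_1,\dots,g_n,f)$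 is a generic commuting $(n+1)$-tuple is comeagre in $C(g_1,\dots,g_n)$. 3. For every generic commuting $n$-tuple $(g_1,\dots,g_n)$, the group $C(g_1,\dots,g_n)$ has a conjugacy class (for conjugation by elements of $C(g_1,\dots,g_n)$) that is comeagre in $C(g_1,\dots,g_n)$. -/

import Mathlib

/-- The rational Urysohn metric space `ℚ𝕌`: a countable metric space with only rational distances
such that every isometric embedding `φ` of a finite metric space `X = Y \ {y}` extends to the
one-point metric extension `Y = X ∪ {y}`, whenever all distances in `Y` are rational. (The case
`X = ∅` makes the space non-empty.)  These properties determine the space up to isometry. -/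
structure IsRationalUrysohn (U : Type*) [MetricSpace U] : Prop where
  countable : Countable U
  rational : ∀ a b : U, ∃ q : ℚ, dist a b = q
  extension : ∀ (Y : Type) [MetricSpace Y] [Finite Y],
    (∀ a b : Y, ∃ q : ℚ, dist a b = q) →
    ∀ (y : Y) (φ : {x : Y // x ≠ y} → U), Isometry φ →
      ∃ ψ : Y → U, Isometry ψ ∧ ∀ x : {x : Y // x ≠ y}, ψ x = φ x

/-- The permutation group topology on `Isom(U)`, the group of isometries of `U` onto itself: the
basic open sets are `{g | ∀ x ∈ A, g x = f x}` for an isometry `f` and a finite set `A`. -/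
instance isomPermutationTopology (U : Type*) [MetricSpace U] : TopologicalSpace (U ≃ᵢ U) :=
  TopologicalSpace.generateFrom
    {V | ∃ (f : U ≃ᵢ U) (A : Finset U), V = {g : U ≃ᵢ U | ∀ x ∈ A, g x = f x}}

/-- The space of commuting `n`-tuples in `G`, with the subspace topology inherited from `G ^ n`
(this is the space of homomorphisms from `ℤ ^ n` to `G`). -/
abbrev CommutingTuples (G : Type*) [Group G] (n : ℕ) : Type _ :=
  {g : Fin n → G // ∀ i j, g i * g j = g j * g i}

/-- `g` is a generic commuting `n`-tuple: it is a commuting tuple, and its orbit under diagonal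
conjugation by `G` is comeagre in the space of all commuting `n`-tuples. -/
def IsGenericCommutingTuple {G : Type*} [Group G] [TopologicalSpace G] {n : ℕ}
    (g : Fin n → G) : Prop :=
  (∀ i j, g i * g j = g j * g i) ∧
    {h : CommutingTuples G n | ∃ k : G, ∀ i, k * g i * k⁻¹ = h.1 i} ∈
      residual (CommutingTuples G n)

/-! Existence of the rational Urysohn space. It is the metric quotient of a pseudometric on `ℕ`
which is built by adding one point at a time. -/

namespace RationalUrysohnExistence

structure IsPM (D : ℕ → ℕ → ℚ) : Prop where
  self : ∀ i, D i i = 0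
  symm : ∀ i j, D i j = D j i
  tri : ∀ i j k, D i k ≤ D i j + D j k

theorem IsPM.nonneg {D : ℕ → ℕ → ℚ} (h : IsPM D) (i j : ℕ) : 0 ≤ D i j := by
  have h1 := h.tri i j i
  have h2 := h.self i
  have h3 := h.symm i j
  linarith

def Kat (D : ℕ → ℕ → ℚ) (f : ℕ → ℚ) : Prop :=
  ∀ i j, f i ≤ f j + D i j ∧ D i j ≤ f i + f j

def KatOn (D : ℕ → ℕ → ℚ) (t : Finset (ℕ × ℚ)) : Prop :=
  ∀ a ∈ t, ∀ b ∈ t, a.2 ≤ b.2 + D a.1 b.1 ∧ D a.1 b.1 ≤ a.2 + b.2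

theorem IsPM.kat_row {D : ℕ → ℕ → ℚ} (h : IsPM D) (m : ℕ) : Kat D (D m) := by
  intro i j
  have h1 := h.tri m j i
  have h2 := h.symm i j
  have h3 := h.tri i m j
  have h4 := h.symm i m
  constructor <;> linarith

theorem exists_kat {D : ℕ → ℕ → ℚ} (h : IsPM D) (t : Finset (ℕ × ℚ)) (ht : KatOn D t) :
    ∃ f, Kat D f ∧ ∀ a ∈ t, f a.1 = a.2 := by
  rcases t.eq_empty_or_nonempty with rfl | hne
  · exact ⟨D 0, h.kat_row 0, by simp⟩
  · refine ⟨fun j => t.inf' hne (fun a => a.2 + D a.1 j), ?_, ?_⟩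
    · intro i j
      obtain ⟨b, hb, hbj⟩ := t.exists_mem_eq_inf' hne (fun a => a.2 + D a.1 j)
      obtain ⟨a, ha, hai⟩ := t.exists_mem_eq_inf' hne (fun a => a.2 + D a.1 i)
      dsimp only at hbj hai ⊢
      constructor
      · have h1 := t.inf'_le (fun a => a.2 + D a.1 i) hb
        have h2 := h.tri b.1 j i
        have h3 := h.symm i j
        linarith
      · have h1 := (ht a ha b hb).2
        have h2 := h.tri i a.1 j
        have h3 := h.tri a.1 b.1 j
        have h4 := h.symm i a.1
        linarith
    · intro a ha
      apply le_antisymm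
      · have h1 := t.inf'_le (fun b => b.2 + D b.1 a.1) ha
        have h2 := h.self a.1
        linarith
      · refine Finset.le_inf' hne _ fun b hb => ?_
        have h1 := (ht a ha b hb).1
        have h2 := h.symm a.1 b.1
        linarith

def upd (D : ℕ → ℕ → ℚ) (n : ℕ) (f : ℕ → ℚ) (i j : ℕ) : ℚ :=
  if i = n then (if j = n then 0 else f j) else if j = n then f i else D i j

theorem IsPM.upd {D : ℕ → ℕ → ℚ} (h : IsPM D) (n : ℕ) {f : ℕ → ℚ} (hf : Kat D f) :
    IsPM (upd D n f) := by
  have h0 : ∀ i, 0 ≤ f i := fun i => by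
    have := (hf i i).2
    have := h.self i
    linarith
  refine ⟨fun i => ?_, fun i j => ?_, fun i j k => ?_⟩
  · unfold RationalUrysohnExistence.upd
    split_ifs
    · rfl
    · exact h.self i
  · have := h.symm i j
    unfold RationalUrysohnExistence.upd
    split_ifs <;> first | rfl | assumption
  · have h1 := h.tri i j k
    have h2 := hf i j
    have h3 := hf i k
    have h4 := hf j k
    have h5 := h.symm j k
    have h6 := hf k j
    have h7 := h0 i
    have h8 := h0 j
    have h9 := h0 k
    unfold RationalUrysohnExistence.upd
    split_ifs <;> linarith

open Classical in
noncomputable def newRow (D : ℕ → ℕ → ℚ) (t : Finset (ℕ × ℚ)) : ℕ → ℚ :=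
  if h : ∃ f, Kat D f ∧ ∀ a ∈ t, f a.1 = a.2 then h.choose else D 0

theorem kat_newRow {D : ℕ → ℕ → ℚ} (h : IsPM D) (t : Finset (ℕ × ℚ)) :
    Kat D (newRow D t) := by
  unfold newRow
  split_ifs with h'
  · exact h'.choose_spec.1
  · exact h.kat_row 0

noncomputable def stage (e : ℕ → Finset (ℕ × ℚ)) : ℕ → ℕ → ℕ → ℚ
  | 0 => fun _ _ => 0
  | n + 1 => upd (stage e n) n (newRow (stage e n) (e n.unpair.1))

theorem isPM_stage (e : ℕ → Finset (ℕ × ℚ)) (n : ℕ) : IsPM (stage e n) := by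
  induction n with
  | zero => exact ⟨fun _ => rfl, fun _ _ => rfl, fun _ _ _ => by simp [stage]⟩
  | succ n ih => exact ih.upd n (kat_newRow ih _)

theorem stage_eq (e : ℕ → Finset (ℕ × ℚ)) {n N i j : ℕ} (hi : i < n) (hj : j < n)
    (hN : n ≤ N) : stage e N i j = stage e n i j := by
  induction N, hN using Nat.le_induction with
  | base => rfl
  | succ N hN ih =>
    rw [← ih, stage, upd, if_neg (by omega), if_neg (by omega)]

theorem exists_pm : ∃ D : ℕ → ℕ → ℚ, IsPM D ∧
    ∀ t : Finset (ℕ × ℚ), KatOn D t → ∃ n, ∀ a ∈ t, D n a.1 = a.2 := by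
  obtain ⟨e, he⟩ := exists_surjective_nat (Finset (ℕ × ℚ))
  have key : ∀ N i j, i < N → j < N → stage e (i + j + 1) i j = stage e N i j := by
    intro N i j hi hj
    rw [← stage_eq e (N := max N (i + j + 1)) hi hj (le_max_left _ _),
      stage_eq e (n := i + j + 1) (by omega) (by omega) (le_max_right _ _)]
  refine ⟨fun i j => stage e (i + j + 1) i j, ⟨fun i => ?_, fun i j => ?_, fun i j k => ?_⟩, ?_⟩
  · exact (isPM_stage e _).self i
  · rw [(isPM_stage e _).symm i j, add_comm i j]
  · rw [key (i + j + k + 1) i j (by omega) (by omega), key (i + j + k + 1) i k (by omega) (by omega),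
      key (i + j + k + 1) j k (by omega) (by omega)]
    exact (isPM_stage e _).tri i j k
  · intro t ht
    obtain ⟨k, rfl⟩ := he t
    obtain ⟨m, hm⟩ : ∃ m, ∀ a ∈ e k, a.1 < m :=
      ⟨(e k).sup Prod.fst + 1, fun a ha => Nat.lt_succ_of_le (Finset.le_sup (f := Prod.fst) ha)⟩
    set n := Nat.pair k m with hn
    have hmn : ∀ a ∈ e k, a.1 < n := fun a ha => (hm a ha).trans_le (Nat.right_le_pair k m)
    have hk : KatOn (stage e n) (e k) := by
      intro a ha b hb
      have := ht a ha b hb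
      dsimp only at this
      rwa [key n a.1 b.1 (hmn a ha) (hmn b hb)] at this
    have hex := exists_kat (isPM_stage e n) _ hk
    refine ⟨n, fun a ha => ?_⟩
    have hlt := hmn a ha
    dsimp only
    rw [key (n + 1) n a.1 (by omega) (by omega), stage, upd, if_pos rfl, if_neg (by omega), hn,
      Nat.unpair_pair, ← hn, newRow, dif_pos hex]
    exact hex.choose_spec.2 a ha

theorem isRationalUrysohn_separationQuotient (X : Type) [PseudoMetricSpace X] [Countable X]
    (D : X → X → ℚ) (hD : ∀ x y, dist x y = D x y)
    (hext : ∀ t : Finset (X × ℚ),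
      (∀ a ∈ t, ∀ b ∈ t, a.2 ≤ b.2 + D a.1 b.1 ∧ D a.1 b.1 ≤ a.2 + b.2) →
      ∃ n, ∀ a ∈ t, D n a.1 = a.2) :
    IsRationalUrysohn (SeparationQuotient X) where
  countable := (SeparationQuotient.surjective_mk (X := X)).countable
  rational a b := by
    obtain ⟨x, rfl⟩ := SeparationQuotient.surjective_mk a
    obtain ⟨y, rfl⟩ := SeparationQuotient.surjective_mk b
    exact ⟨D x y, by rw [SeparationQuotient.dist_mk, hD]⟩
  extension Y _ _ hY y φ hφ := by
    classical
    have := Fintype.ofFinite Y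
    choose q hq using hY
    choose r hr using fun x => SeparationQuotient.surjective_mk (φ x)
    have hrD : ∀ a b, D (r a) (r b) = q a b := by
      intro a b
      have h1 : dist (φ a) (φ b) = dist a b := hφ.dist_eq a b
      rw [← hr a, ← hr b, SeparationQuotient.dist_mk, hD, Subtype.dist_eq, hq] at h1
      exact_mod_cast h1
    obtain ⟨n, hn⟩ := hext (Finset.univ.image fun x => (r x, q x y)) (by
      intro a ha b hb
      simp only [Finset.mem_image, Finset.mem_univ, true_and] at ha hb
      obtain ⟨a, rfl⟩ := ha
      obtain ⟨b, rfl⟩ := hb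
      dsimp only
      rw [hrD]
      have h1 := dist_triangle (a : Y) b y
      have h2 := dist_triangle_right (a : Y) b y
      rw [hq, hq, hq] at h1 h2
      norm_cast at h1 h2
      exact ⟨by linarith, h2⟩)
    have hn' : ∀ x, dist (SeparationQuotient.mk n) (φ x) = dist (x : Y) y := by
      intro x
      have h1 := hn (r x, q x y) (Finset.mem_image_of_mem _ (Finset.mem_univ x))
      rw [← hr x, SeparationQuotient.dist_mk, hD, hq]
      exact_mod_cast h1
    refine ⟨fun x => if h : x = y then SeparationQuotient.mk n else φ ⟨x, h⟩, ?_, ?_⟩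
    · refine Isometry.of_dist_eq fun a b => ?_
      by_cases ha : a = y <;> by_cases hb : b = y
      · simp [ha, hb]
      · rw [dif_pos ha, dif_neg hb, hn', ha, dist_comm]
      · rw [dif_neg ha, dif_pos hb, dist_comm, hn', hb]
      · rw [dif_neg ha, dif_neg hb, hφ.dist_eq, Subtype.dist_eq]
    · rintro ⟨x, hx⟩
      simp [hx]

end RationalUrysohnExistence

/-- The rational Urysohn space exists. -/
theorem exists_isRationalUrysohn : ∃ (U : Type) (_ : MetricSpace U), IsRationalUrysohn U := by
  obtain ⟨D, hD, hext⟩ := RationalUrysohnExistence.exists_pm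
  let _ : PseudoMetricSpace ℕ :=
    { dist := fun i j => (D i j : ℝ)
      dist_self := fun i => by simp [hD.self i]
      dist_comm := fun i j => by simp [hD.symm i j]
      dist_triangle := fun i j k => by exact_mod_cast hD.tri i j k }
  exact ⟨_, inferInstance,
    RationalUrysohnExistence.isRationalUrysohn_separationQuotient ℕ D (fun _ _ => rfl) hext⟩

/-! Generic commuting tuples are exactly the universal ones (`IsUniversalTuple`): every point has a
finite invariant neighbourhood of points, and every finite system of commuting isometries extending
the tuple on a finite invariant set is realized by the tuple over that set. Back and forth makes any
two universal tuples of the same length conjugate (`exists_conj_eq`). Universality is a Gδ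
condition, since it consists of countably many conditions about finitely many points. Once universal
tuples are known to be dense, they form a comeagre set lying in a single orbit. Conversely a
comeagre orbit must meet this set, by Baire, and universality is invariant under conjugation.

Density rests on replacing commuting isometries, on a given finite set, by commuting isometries of a
finite space. The tuple generates a finitely generated commutative group, in which every subgroup is
an intersection of subgroups of finite index. This allows an invariant path pseudometric to be
divided by a subgroup of finite index without changing the finitely many prescribed distances
(`exists_invariant_dist`).

Inside the centraliser of a universal tuple `g`, the elements `f` for which `(g, f)` is universal
are again comeagre. This needs free amalgams of finite systems (`IsFinAct.exists_amalgam`) and the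
totalization of an isometry given on a part (`IsFinAct.exists_total`), combined in `exists_snoc`. If
`(g, f)` and `(g, f')` are both universal, an element conjugating one to the other fixes `g` under
conjugation. It therefore lies in the centraliser, and all such `f` form part of one conjugacy class
there. -/

namespace RationalUrysohn

open Topology

/-! ### Realizing finite rational pseudometrics in `U`. -/

variable {U : Type*} [MetricSpace U]

/-- The one-point extension of a metric space by a positive Katětov function. -/
abbrev optionMetric {F : Type} [MetricSpace F] (ρ : F → ℝ) (hpos : ∀ i, 0 < ρ i)
    (h1 : ∀ i j, ρ i ≤ ρ j + dist i j) (h2 : ∀ i j, dist i j ≤ ρ i + ρ j) :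
    MetricSpace (Option F) where
  dist
    | none, none => 0
    | none, some i => ρ i
    | some i, none => ρ i
    | some i, some j => dist i j
  dist_self x := by cases x <;> simp
  dist_comm x y := by cases x <;> cases y <;> simp [dist_comm]
  dist_triangle x y z := by
    cases x <;> cases y <;> cases z <;> simp only []
    · simp
    · simp
    · rename_i i; linarith [hpos i]
    · rename_i i j; linarith [h1 j i, dist_comm i j]
    · simp
    · exact h2 _ _
    · rename_i i j; linarith [h1 i j]
    · exact dist_triangle _ _ _
  eq_of_dist_eq_zero {x y} h := by
    cases x <;> cases y
    · rfl
    · rename_i i; exact absurd h (hpos i).ne'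
    · rename_i i; exact absurd h (hpos i).ne'
    · exact congrArg some (eq_of_dist_eq_zero h)

/-- The extension property for Katětov functions, freed from positivity and injectivity: a zero
value of `r` forces the new point to be an old one, and otherwise the one-point extension is a
genuine metric space. -/
theorem exists_dist_eq (hU : IsRationalUrysohn U) {X : Type*} (S : Finset X) (ψ : X → U)
    (r : X → ℝ) (hr : ∀ s ∈ S, ∃ q : ℚ, r s = q)
    (h1 : ∀ s ∈ S, ∀ t ∈ S, r s ≤ r t + dist (ψ s) (ψ t))
    (h2 : ∀ s ∈ S, ∀ t ∈ S, dist (ψ s) (ψ t) ≤ r s + r t) :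
    ∃ u, ∀ s ∈ S, dist u (ψ s) = r s := by
  classical
  by_cases h0 : ∃ s ∈ S, r s = 0
  · obtain ⟨s, hs, h0⟩ := h0
    refine ⟨ψ s, fun t ht => le_antisymm ?_ ?_⟩
    · linarith [h2 s hs t ht]
    · linarith [h1 t ht s hs, dist_comm (ψ s) (ψ t)]
  push Not at h0
  have hpos : ∀ s ∈ S, 0 < r s := fun s hs =>
    lt_of_le_of_ne (by linarith [h2 s hs s hs, dist_self (ψ s)]) (h0 s hs).symm
  have hF : ∀ u : {u // u ∈ S.image ψ}, ∃ s ∈ S, ψ s = u := fun u => Finset.mem_image.1 u.2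
  choose σ hσ hσu using hF
  let e := (S.image ψ).equivFin
  -- The extension property speaks of spaces in `Type`, so the image of `S` is copied onto some `Fin
  -- m`, whatever the universe of `U`.
  let _ : MetricSpace (Fin (S.image ψ).card) :=
    MetricSpace.induced (fun i => ((e.symm i : {u // u ∈ S.image ψ}) : U))
      (Subtype.val_injective.comp e.symm.injective) inferInstance
  have hd : ∀ i j : Fin (S.image ψ).card,
      dist i j = dist (ψ (σ (e.symm i))) (ψ (σ (e.symm j))) := by
    intro i j; rw [hσu, hσu]; rfl
  let _ := optionMetric (fun i => r (σ (e.symm i))) (fun i => hpos _ (hσ _))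
    (fun i j => by rw [hd]; exact h1 _ (hσ _) _ (hσ _))
    (fun i j => by rw [hd]; exact h2 _ (hσ _) _ (hσ _))
  have hsome : ∀ x : {x : Option (Fin (S.image ψ).card) // x ≠ none}, ∃ i, x.1 = some i :=
    fun x => Option.ne_none_iff_exists'.1 x.2
  choose ν hν using hsome
  obtain ⟨φ, hφ, hφx⟩ := hU.extension (Option (Fin (S.image ψ).card))
    (by
      intro a b
      cases a with
      | none =>
        cases b with
        | none => exact ⟨0, by simp⟩
        | some j => exact hr _ (hσ (e.symm j))
      | some i =>
        cases b with
        | none => exact hr _ (hσ (e.symm i))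
        | some j => exact hU.rational _ _)
    none (fun x => ((e.symm (ν x) : {u // u ∈ S.image ψ}) : U))
    (Isometry.of_dist_eq fun a b => by
      rw [Subtype.dist_eq, hν a, hν b]; rfl)
  refine ⟨φ none, fun s hs => ?_⟩
  set u : {u // u ∈ S.image ψ} := ⟨ψ s, Finset.mem_image_of_mem _ hs⟩ with hu
  have h3 := hφx ⟨some (e u), by simp⟩
  have h4 : ν ⟨some (e u), by simp⟩ = e u := 
    (Option.some_injective _ (hν ⟨some (e u), by simp⟩)).symm
  rw [h4, Equiv.symm_apply_apply] at h3
  have h5 := hφ.dist_eq none (some (e u))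
  change dist (φ none) (φ (some (e u))) = r (σ (e.symm (e u))) at h5
  rw [h3, Equiv.symm_apply_apply] at h5
  have h6 : ψ (σ u) = ψ s := hσu u
  have h7 := h1 s hs _ (hσ u)
  have h8 := h1 _ (hσ u) s hs
  rw [h6, dist_self] at h7 h8
  rw [show ψ s = (u : U) from rfl, h5]
  linarith

/-- A pseudodistance with rational values. -/
structure IsRatDist {X : Type*} (D : X → X → ℝ) : Prop where
  self : ∀ x, D x x = 0
  symm : ∀ x y, D x y = D y x
  tri : ∀ x y z, D x z ≤ D x y + D y z
  rat : ∀ x y, ∃ q : ℚ, D x y = q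

/-- A rational pseudometric space with finitely many points at pairwise positive distance can be
mapped into `U`, extending a given map on a finite part. -/
theorem exists_realization (hU : IsRationalUrysohn U) {X : Type*} {D : X → X → ℝ}
    (hD : IsRatDist D) (hfin : ∃ S : Finset X, ∀ x, ∃ s ∈ S, D x s = 0) (A : Finset U) (e : U → X)
    (he : ∀ a ∈ A, ∀ b ∈ A, D (e a) (e b) = dist a b) :
    ∃ ψ : X → U, (∀ x y, dist (ψ x) (ψ y) = D x y) ∧ ∀ a ∈ A, ψ (e a) = a := by
  classical
  have key : ∀ S : Finset X, ∃ ψ : X → U,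
      (∀ x ∈ S ∪ A.image e, ∀ y ∈ S ∪ A.image e, dist (ψ x) (ψ y) = D x y) ∧
        ∀ a ∈ A, ψ (e a) = a := by
    intro S
    induction S using Finset.induction_on with
    | empty =>
      -- The point `u0` is only a default value off the image of `A`. Extending the empty map to a
      -- one-point space shows that `U` is nonempty.
      obtain ⟨u0, -⟩ := exists_dist_eq hU (∅ : Finset Unit) (fun _ => Classical.choice (by
        obtain ⟨φ, -⟩ := hU.extension Unit (fun _ _ => ⟨0, by simp⟩) ()
          (fun x => absurd rfl x.2) (fun x => absurd rfl x.2)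
        exact ⟨φ ()⟩)) (fun _ => 0) (by simp) (by simp) (by simp)
      let ψ : X → U := fun x => if h : ∃ a ∈ A, e a = x then h.choose else u0
      have hψ : ∀ a ∈ A, ψ (e a) = a := by
        intro a ha
        have h : ∃ b ∈ A, e b = e a := ⟨a, ha, rfl⟩
        have h1 : ψ (e a) = h.choose := dif_pos h
        obtain ⟨h2, h3⟩ := h.choose_spec
        rw [h1]
        have := he _ h2 _ ha
        rw [h3, hD.self] at this
        exact (eq_of_dist_eq_zero this.symm)
      refine ⟨ψ, ?_, hψ⟩
      simp only [Finset.empty_union, Finset.mem_image]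
      rintro _ ⟨a, ha, rfl⟩ _ ⟨b, hb, rfl⟩
      rw [hψ a ha, hψ b hb, he a ha b hb]
    | insert x S hx ih =>
      obtain ⟨ψ, hψ, hψe⟩ := ih
      by_cases hxA : x ∈ S ∪ A.image e
      · refine ⟨ψ, ?_, hψe⟩
        rwa [Finset.insert_union, Finset.insert_eq_of_mem hxA]
      · obtain ⟨u, hu⟩ := exists_dist_eq hU (S ∪ A.image e) ψ (fun y => D x y)
          (fun y _ => hD.rat x y)
          (fun s hs t ht => by rw [hψ s hs t ht]; linarith [hD.tri x t s, hD.symm s t])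
          (fun s hs t ht => by rw [hψ s hs t ht]; linarith [hD.tri s x t, hD.symm s x])
        have hne : ∀ y ∈ S ∪ A.image e, y ≠ x := fun y hy h => hxA (h ▸ hy)
        refine ⟨Function.update ψ x u, ?_, fun a ha => ?_⟩
        · intro y hy z hz
          rw [Finset.insert_union, Finset.mem_insert] at hy hz
          rcases hy with rfl | hy <;> rcases hz with rfl | hz
          · simp [hD.self]
          · rw [Function.update_self, Function.update_of_ne (hne z hz), hu z hz]
          · rw [Function.update_self, Function.update_of_ne (hne y hy), dist_comm, hu y hy, hD.symm]
          · rw [Function.update_of_ne (hne z hz), Function.update_of_ne (hne y hy), hψ y hy z hz]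
        · rw [Function.update_of_ne (hne _ (Finset.mem_union_right _
            (Finset.mem_image_of_mem _ ha))), hψe a ha]
  obtain ⟨S, hS⟩ := hfin
  choose ν hνS hν using hS
  obtain ⟨ψ, hψ, hψe⟩ := key S
  refine ⟨fun x => ψ (ν x), fun x y => ?_, fun a ha => ?_⟩
  · rw [hψ _ (Finset.mem_union_left _ (hνS x)) _ (Finset.mem_union_left _ (hνS y))]
    have h1 := hD.symm (ν x) x
    have h2 := hD.symm (ν y) y
    have h3 := hν x
    have h4 := hν y
    apply le_antisymm
    · linarith [hD.tri (ν x) x (ν y), hD.tri x y (ν y)]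
    · linarith [hD.tri x (ν x) y, hD.tri (ν x) (ν y) y]
  · have h1 := hψ _ (Finset.mem_union_left _ (hνS (e a))) (e a)
      (Finset.mem_union_right _ (Finset.mem_image_of_mem _ ha))
    rw [hD.symm, hν, hψe a ha] at h1
    exact eq_of_dist_eq_zero h1

/-! ### Back and forth, and homogeneity of `U`. -/

/-- Pairs of a finite set and a map on it, ordered by extension. -/
structure PartialMap (Q : Finset U → (U → U) → Prop) where
  dom : Finset U
  map : U → U
  prop : Q dom map

instance (Q : Finset U → (U → U) → Prop) : Preorder (PartialMap Q) where
  le a b := a.dom ⊆ b.dom ∧ ∀ x ∈ a.dom, b.map x = a.map x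
  le_refl a := ⟨subset_rfl, fun _ _ => rfl⟩
  le_trans a b c h1 h2 := ⟨h1.1.trans h2.1, fun x hx => by rw [h2.2 x (h1.1 hx), h1.2 x hx]⟩

/-- A family of finite partial isometries with the back and forth property contains a chain whose
union is an isometry of `U` onto itself, and which meets countably many cofinal sets. -/
theorem exists_isometryEquiv_of_backAndForth [Countable U] {ι : Type*} [Countable ι]
    (Q : Finset U → (U → U) → Prop)
    (hQ : ∀ Y φ, Q Y φ → ∀ x ∈ Y, ∀ y ∈ Y, dist (φ x) (φ y) = dist x y)
    (forth : ∀ Y φ, Q Y φ → ∀ x, ∃ Z χ, Q Z χ ∧ Y ⊆ Z ∧ (∀ y ∈ Y, χ y = φ y) ∧ x ∈ Z)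
    (back : ∀ Y φ, Q Y φ → ∀ x, ∃ Z χ, Q Z χ ∧ Y ⊆ Z ∧ (∀ y ∈ Y, χ y = φ y) ∧ ∃ z ∈ Z, χ z = x)
    (T : ι → Finset U → (U → U) → Prop)
    (hT : ∀ i Y φ, Q Y φ → ∃ Z χ, Q Z χ ∧ Y ⊆ Z ∧ (∀ y ∈ Y, χ y = φ y) ∧ T i Z χ)
    {Y : Finset U} {φ : U → U} (hY : Q Y φ) :
    ∃ h : U ≃ᵢ U, (∀ y ∈ Y, h y = φ y) ∧
      (∀ i, ∃ Z χ, Q Z χ ∧ T i Z χ ∧ ∀ z ∈ Z, h z = χ z) ∧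
      ∀ x, ∃ Z χ, Q Z χ ∧ x ∈ Z ∧ ∀ z ∈ Z, h z = χ z := by
  classical
  -- Rasiowa–Sikorski: an ideal meeting these countably many cofinal sets glues to a map that is
  -- total, onto, and satisfies every requirement `T i` at some finite stage.
  let 𝒟 : U ⊕ U ⊕ ι → Order.Cofinal (PartialMap Q) := fun k => match k with
    | .inl x => ⟨{p | x ∈ p.dom}, fun p => by
        obtain ⟨Z, χ, h1, h2, h3, h4⟩ := forth p.dom p.map p.prop x
        exact ⟨⟨Z, χ, h1⟩, h4, h2, h3⟩⟩
    | .inr (.inl x) => ⟨{p | ∃ z ∈ p.dom, p.map z = x}, fun p => by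
        obtain ⟨Z, χ, h1, h2, h3, h4⟩ := back p.dom p.map p.prop x
        exact ⟨⟨Z, χ, h1⟩, h4, h2, h3⟩⟩
    | .inr (.inr i) => ⟨{p | T i p.dom p.map}, fun p => by
        obtain ⟨Z, χ, h1, h2, h3, h4⟩ := hT i p.dom p.map p.prop
        exact ⟨⟨Z, χ, h1⟩, h4, h2, h3⟩⟩
  let _ := Encodable.ofCountable (U ⊕ U ⊕ ι)
  let p0 : PartialMap Q := ⟨Y, φ, hY⟩
  let I := Order.idealOfCofinals p0 𝒟
  have hI : ∀ k, ∃ p, p ∈ 𝒟 k ∧ p ∈ I := fun k => Order.cofinal_meets_idealOfCofinals p0 𝒟 k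
  have hp0 : p0 ∈ I := Order.mem_idealOfCofinals p0 𝒟
  have hdir : ∀ p ∈ I, ∀ q ∈ I, ∃ r ∈ I, p ≤ r ∧ q ≤ r := fun p hp q hq => by
    obtain ⟨r, hr, h1, h2⟩ := I.directed p hp q hq
    exact ⟨r, hr, h1, h2⟩
  choose P hP hPI using fun x => hI (.inl x)
  choose R hR hRI using fun x => hI (.inr (.inl x))
  choose β hβ hβx using hR
  have hP' : ∀ x, x ∈ (P x).dom := hP
  let f : U → U := fun x => (P x).map x
  have hf : ∀ p ∈ I, ∀ x ∈ p.dom, f x = p.map x := by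
    intro p hp x hx
    obtain ⟨r, -, h1, h2⟩ := hdir p hp (P x) (hPI x)
    rw [← h1.2 x hx, h2.2 x (hP' x)]
  have hfd : ∀ x y, dist (f x) (f y) = dist x y := by
    intro x y
    obtain ⟨r, hr, h1, h2⟩ := hdir (P x) (hPI x) (P y) (hPI y)
    rw [hf r hr x (h1.1 (hP' x)), hf r hr y (h2.1 (hP' y))]
    exact hQ _ _ r.prop _ (h1.1 (hP' x)) _ (h2.1 (hP' y))
  have hfs : ∀ x, f (β x) = x := fun x => by rw [hf _ (hRI x) _ (hβ x), hβx]
  let h : U ≃ᵢ U := IsometryEquiv.mk' f β hfs (Isometry.of_dist_eq hfd)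
  refine ⟨h, fun y hy => hf p0 hp0 y hy, fun i => ?_, fun x => ?_⟩
  · obtain ⟨p, hp, hpI⟩ := hI (.inr (.inr i))
    exact ⟨p.dom, p.map, p.prop, hp, fun z hz => hf p hpI z hz⟩
  · exact ⟨(P x).dom, (P x).map, (P x).prop, hP' x, fun z hz => hf _ (hPI x) z hz⟩

/-- Every isometry between finite subsets of `U` extends to an isometry of `U`. -/
theorem exists_isometryEquiv_extending (hU : IsRationalUrysohn U) {Y : Finset U} {φ : U → U}
    (hφ : ∀ x ∈ Y, ∀ y ∈ Y, dist (φ x) (φ y) = dist x y) :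
    ∃ h : U ≃ᵢ U, ∀ y ∈ Y, h y = φ y := by
  classical
  have := hU.countable
  obtain ⟨h, h1, -⟩ := exists_isometryEquiv_of_backAndForth (ι := Empty)
    (fun Y φ => ∀ x ∈ Y, ∀ y ∈ Y, dist (φ x) (φ y) = dist x y) (fun _ _ h => h)
    (by
      intro Y φ hφ x
      by_cases hx : x ∈ Y
      · exact ⟨Y, φ, hφ, subset_rfl, fun _ _ => rfl, hx⟩
      obtain ⟨u, hu⟩ := exists_dist_eq hU Y φ (fun y => dist x y) (fun y _ => hU.rational x y)
        (fun s hs t ht => by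
          rw [hφ s hs t ht]; linarith [dist_triangle x t s, dist_comm s t])
        (fun s hs t ht => by
          rw [hφ s hs t ht]; linarith [dist_triangle s x t, dist_comm s x])
      have hne : ∀ y ∈ Y, y ≠ x := fun y hy h => hx (h ▸ hy)
      refine ⟨insert x Y, Function.update φ x u, ?_, Finset.subset_insert _ _,
        fun y hy => Function.update_of_ne (hne y hy) _ _, Finset.mem_insert_self _ _⟩
      intro y hy z hz
      rw [Finset.mem_insert] at hy hz
      rcases hy with rfl | hy <;> rcases hz with rfl | hz
      · simp
      · rw [Function.update_self, Function.update_of_ne (hne z hz), hu z hz]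
      · rw [Function.update_self, Function.update_of_ne (hne y hy), dist_comm, hu y hy, dist_comm]
      · rw [Function.update_of_ne (hne z hz), Function.update_of_ne (hne y hy), hφ y hy z hz])
    (by
      intro Y φ hφ x
      by_cases hx : ∃ y ∈ Y, φ y = x
      · exact ⟨Y, φ, hφ, subset_rfl, fun _ _ => rfl, hx⟩
      obtain ⟨u, hu⟩ := exists_dist_eq hU Y id (fun y => dist x (φ y))
        (fun y _ => hU.rational _ _)
        (fun s hs t ht => by
          simp only [id]
          rw [← hφ s hs t ht]; linarith [dist_triangle x (φ t) (φ s), dist_comm (φ s) (φ t)])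
        (fun s hs t ht => by
          simp only [id]
          rw [← hφ s hs t ht]; linarith [dist_triangle (φ s) x (φ t), dist_comm (φ s) x])
      have hne : ∀ y ∈ Y, y ≠ u := by
        rintro y hy rfl
        have := hu y hy
        rw [id, dist_self] at this
        exact hx ⟨y, hy, (eq_of_dist_eq_zero this.symm).symm⟩
      refine ⟨insert u Y, Function.update φ u x, ?_, Finset.subset_insert _ _,
        fun y hy => Function.update_of_ne (hne y hy) _ _, u, Finset.mem_insert_self _ _,
        Function.update_self _ _ _⟩
      intro y hy z hz
      rw [Finset.mem_insert] at hy hz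
      rcases hy with rfl | hy <;> rcases hz with rfl | hz
      · simp
      · rw [Function.update_self, Function.update_of_ne (hne z hz), ← hu z hz, id]
      · rw [Function.update_self, Function.update_of_ne (hne y hy), dist_comm, ← hu y hy, dist_comm,
          id]
      · rw [Function.update_of_ne (hne z hz), Function.update_of_ne (hne y hy), hφ y hy z hz])
    (fun i => i.elim) (fun i => i.elim) hφ
  exact ⟨h, h1⟩

/-! ### Free amalgamation over a set of hubs. -/

open Classical in
/-- The free amalgam of the parts of a labelled set over a set of hubs. -/
noncomputable def hubDist {X ι O : Type*} [Fintype O] [Nonempty O] (lab : X → ι) (D : X → X → ℝ)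
    (c : X → O → ℝ) (x y : X) : ℝ :=
  if lab x = lab y then D x y
  else Finset.univ.inf' Finset.univ_nonempty fun o => c x o + c y o

section Hub

variable {X ι O : Type*} [Fintype O] [Nonempty O] {lab : X → ι} {D : X → X → ℝ} {c : X → O → ℝ}

theorem hubDist_of_eq {x y : X} (h : lab x = lab y) : hubDist lab D c x y = D x y := if_pos h

theorem hubDist_le {x y : X} (h : lab x ≠ lab y) (o : O) :
    hubDist lab D c x y ≤ c x o + c y o := by
  rw [hubDist, if_neg h]
  exact Finset.inf'_le _ (Finset.mem_univ o)

theorem exists_hubDist_eq {x y : X} (h : lab x ≠ lab y) :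
    ∃ o, hubDist lab D c x y = c x o + c y o := by
  rw [hubDist, if_neg h]
  obtain ⟨o, -, ho⟩ := Finset.exists_mem_eq_inf' Finset.univ_nonempty fun o : O => c x o + c y o
  exact ⟨o, ho⟩

/-- Here `c x o` plays the distance from `x` to the copy of the hub `o` in its own part, and `E` the
distances among hubs. The essential case is a path from `x` to `z` using two hubs `o`, `o'` around
`y`: its middle piece is at least `E o' o`, so the path through `o'` alone is no longer. -/
theorem isRatDist_hubDist (hD : IsRatDist D) (E : O → O → ℝ)
    (hr : ∀ x o, ∃ q : ℚ, c x o = q)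
    (h1 : ∀ x o o', c x o ≤ c x o' + E o o') (h2 : ∀ x o o', E o o' ≤ c x o + c x o')
    (h3 : ∀ x y o, lab x = lab y → c x o ≤ D x y + c y o)
    (h4 : ∀ x y o, lab x = lab y → D x y ≤ c x o + c y o) : IsRatDist (hubDist lab D c) where
  self x := by rw [hubDist_of_eq rfl, hD.self]
  symm x y := by
    unfold hubDist
    by_cases h : lab x = lab y
    · rw [if_pos h, if_pos h.symm, hD.symm]
    · rw [if_neg h, if_neg (Ne.symm h)]
      simp only [add_comm]
  rat x y := by
    by_cases h : lab x = lab y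
    · rw [hubDist_of_eq h]
      exact hD.rat x y
    · obtain ⟨o, ho⟩ := exists_hubDist_eq (D := D) (c := c) h
      obtain ⟨q, hq⟩ := hr x o
      obtain ⟨q', hq'⟩ := hr y o
      exact ⟨q + q', by rw [ho, hq, hq', Rat.cast_add]⟩
  tri x y z := by
    by_cases hxy : lab x = lab y
    · rw [hubDist_of_eq hxy]
      by_cases hyz : lab y = lab z
      · rw [hubDist_of_eq hyz, hubDist_of_eq (hxy.trans hyz)]
        exact hD.tri x y z
      · obtain ⟨o, ho⟩ := exists_hubDist_eq (D := D) (c := c) hyz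
        have := hubDist_le (D := D) (c := c) (x := x) (y := z) (fun h => hyz (hxy.symm.trans h)) o
        linarith [h3 x y o hxy]
    · obtain ⟨o, ho⟩ := exists_hubDist_eq (D := D) (c := c) hxy
      by_cases hyz : lab y = lab z
      · rw [hubDist_of_eq hyz]
        have := hubDist_le (D := D) (c := c) (x := x) (y := z) (fun h => hxy (h.trans hyz.symm)) o
        linarith [h3 z y o hyz.symm, hD.symm y z]
      · obtain ⟨o', ho'⟩ := exists_hubDist_eq (D := D) (c := c) hyz
        have h5 := h2 y o' o
        have h6 := h1 x o' o
        by_cases hxz : lab x = lab z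
        · rw [hubDist_of_eq hxz]
          linarith [h4 x z o' hxz]
        · have := hubDist_le (D := D) (c := c) hxz o'
          linarith

theorem hubDist_map {σ : X → X} {τ : O → O} (hτ : Function.Surjective τ)
    (hlab : ∀ x y, lab (σ x) = lab (σ y) ↔ lab x = lab y)
    (hD : ∀ x y, lab x = lab y → D (σ x) (σ y) = D x y)
    (hc : ∀ x o, c (σ x) (τ o) = c x o) (x y : X) :
    hubDist lab D c (σ x) (σ y) = hubDist lab D c x y := by
  by_cases h : lab x = lab y
  · rw [hubDist_of_eq h, hubDist_of_eq ((hlab x y).2 h), hD x y h]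
  · have h' : lab (σ x) ≠ lab (σ y) := fun h' => h ((hlab x y).1 h')
    apply le_antisymm
    · obtain ⟨o, ho⟩ := exists_hubDist_eq (D := D) (c := c) h
      exact (hubDist_le h' (τ o)).trans_eq (by rw [ho, hc, hc])
    · obtain ⟨o, ho⟩ := exists_hubDist_eq (D := D) (c := c) h'
      obtain ⟨o, rfl⟩ := hτ o
      rw [ho, hc, hc]
      exact hubDist_le h _

end Hub

/-- The part labelled `k` is glued to the others along the copy `θ k` of `F`. As the construction is
canonical, maps permuting the parts compatibly with the gluing preserve the amalgam; this is how the
actions are extended to it. -/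
theorem exists_freeAmalgam (hU : IsRationalUrysohn U) {X ι F : Type*} [Finite X] [Finite F]
    (u : X → U) (lab : X → ι) (θ : ι → F → U) (E : F → F → ℝ)
    (hθ : ∀ k a b, dist (θ k a) (θ k b) = E a b) :
    ∃ D : X → X → ℝ, IsRatDist D ∧ (∀ x y, lab x = lab y → D x y = dist (u x) (u y)) ∧
      (∀ x y a, u x = θ (lab x) a → u y = θ (lab y) a → D x y = 0) ∧
      ∀ (σ : X → X) (τ : F → F), Function.Surjective τ →
        (∀ x y, lab (σ x) = lab (σ y) ↔ lab x = lab y) →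
        (∀ x y, lab x = lab y → dist (u (σ x)) (u (σ y)) = dist (u x) (u y)) →
        (∀ x a, dist (u (σ x)) (θ (lab (σ x)) (τ a)) = dist (u x) (θ (lab x) a)) →
        ∀ x y, D (σ x) (σ y) = D x y := by
  classical
  have := Fintype.ofFinite F
  obtain ⟨M, hM0, hM, hM'⟩ : ∃ M : ℚ, (0 : ℝ) ≤ M ∧ (∀ x y, dist (u x) (u y) ≤ 2 * M) ∧
      ∀ x a, dist (u x) (θ (lab x) a) ≤ 2 * M := by
    obtain ⟨B, hB⟩ := (Set.finite_range fun p : X × X => dist (u p.1) (u p.2)).bddAbove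
    obtain ⟨B', hB'⟩ := (Set.finite_range
      fun p : X × F => dist (u p.1) (θ (lab p.1) p.2)).bddAbove
    obtain ⟨q, hq⟩ := exists_rat_gt (max 0 (max B B'))
    have h1 := (le_max_left 0 (max B B'))
    have h2 := (le_max_right 0 (max B B'))
    have h3 := le_max_left B B'
    have h4 := le_max_right B B'
    refine ⟨q, by linarith, fun x y => ?_, fun x a => ?_⟩
    · have := hB ⟨(x, y), rfl⟩
      dsimp only at this
      linarith
    · have := hB' ⟨(x, a), rfl⟩
      dsimp only at this
      linarith
  -- The extra hub `none` lies at distance `M` from everything. It provides a hub even when `F` is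
  -- empty, and the bound `2 * M` on the relevant distances makes it compatible with the triangle
  -- inequality.
  let c : X → Option F → ℝ := fun x o => o.elim M fun a => dist (u x) (θ (lab x) a)
  let E' : Option F → Option F → ℝ
    | none, none => 0
    | none, some _ => M
    | some _, none => M
    | some a, some b => E a b
  have hR : IsRatDist fun x y => dist (u x) (u y) :=
    ⟨fun _ => dist_self _, fun _ _ => dist_comm _ _, fun _ _ _ => dist_triangle _ _ _,
      fun _ _ => hU.rational _ _⟩
  refine ⟨hubDist lab (fun x y => dist (u x) (u y)) c, isRatDist_hubDist hR E' ?_ ?_ ?_ ?_ ?_,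
    fun x y h => hubDist_of_eq h, ?_, ?_⟩
  · rintro x (_ | a)
    · exact ⟨M, rfl⟩
    · exact hU.rational _ _
  · rintro x (_ | a) (_ | b) <;> simp only [c, E', Option.elim]
    · simp
    · linarith [dist_nonneg (x := u x) (y := θ (lab x) b)]
    · linarith [hM' x a]
    · rw [← hθ (lab x) a b]
      linarith [dist_triangle (u x) (θ (lab x) b) (θ (lab x) a),
        dist_comm (θ (lab x) b) (θ (lab x) a)]
  · rintro x (_ | a) (_ | b) <;> simp only [c, E', Option.elim]
    · linarith
    · linarith [dist_nonneg (x := u x) (y := θ (lab x) b)]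
    · linarith [dist_nonneg (x := u x) (y := θ (lab x) a)]
    · rw [← hθ (lab x) a b]
      exact dist_triangle_left _ _ _
  · rintro x y (_ | a) h <;> simp only [c, Option.elim]
    · linarith [dist_nonneg (x := u x) (y := u y)]
    · rw [h]
      exact dist_triangle _ _ _
  · rintro x y (_ | a) h <;> simp only [c, Option.elim]
    · linarith [hM x y]
    · rw [h]
      exact dist_triangle_right _ _ _
  · intro x y a hx hy
    by_cases h : lab x = lab y
    · rw [hubDist_of_eq h, hx, hy, h, dist_self]
    · apply le_antisymm
      · have := hubDist_le (D := fun x y => dist (u x) (u y)) (c := c) h (some a)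
        simpa only [c, Option.elim, hx, hy, dist_self, add_zero] using this
      · obtain ⟨o, ho⟩ := exists_hubDist_eq (D := fun x y => dist (u x) (u y)) (c := c) h
        rw [ho]
        cases o
        · simp only [c, Option.elim]
          linarith
        · exact add_nonneg dist_nonneg dist_nonneg
  · intro σ τ hτ hlab hσ hc x y
    refine hubDist_map (τ := Option.map τ) ?_ hlab hσ ?_ x y
    · rintro (_ | b)
      · exact ⟨none, rfl⟩
      · obtain ⟨a, rfl⟩ := hτ b
        exact ⟨some a, rfl⟩
    · rintro x (_ | a)
      · rfl
      · exact hc x a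

/-! ### Finite systems of commuting isometries. -/

/-- A finite set with commuting self-isometries. -/
structure IsFinAct {n : ℕ} (T : Finset U) (p : Fin n → U → U) : Prop where
  maps : ∀ i, ∀ t ∈ T, p i t ∈ T
  dist_eq : ∀ i, ∀ s ∈ T, ∀ t ∈ T, dist (p i s) (p i t) = dist s t
  comm : ∀ i j, ∀ t ∈ T, p i (p j t) = p j (p i t)

theorem exists_mem_eq_of_isometry {T : Finset U} {f : U → U} (hf : ∀ t ∈ T, f t ∈ T)
    (hd : ∀ s ∈ T, ∀ t ∈ T, dist (f s) (f t) = dist s t) {t : U} (ht : t ∈ T) :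
    ∃ s ∈ T, f s = t := by
  have hinj : Set.InjOn f T := fun a ha b hb h => by
    have := hd a ha b hb
    rw [h, dist_self] at this
    exact eq_of_dist_eq_zero this.symm
  have := Finset.surjOn_of_injOn_of_card_le f (fun a ha => hf a ha) hinj le_rfl ht
  exact this

/-- Points with the same image are at `D`-distance zero, and `σ i` preserves `D`, so the choice of a
preimage in the definition of `p` does not matter. -/
theorem exists_isFinAct_of_realization {n : ℕ} {X : Type*} {D : X → X → ℝ}
    (hfin : ∃ S : Finset X, ∀ x, ∃ s ∈ S, D x s = 0) {σ : Fin n → X → X}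
    (hσ : ∀ i x y, D (σ i x) (σ i y) = D x y) (hcomm : ∀ i j x, σ i (σ j x) = σ j (σ i x))
    {ψ : X → U} (hψ : ∀ x y, dist (ψ x) (ψ y) = D x y) :
    ∃ (T : Finset U) (p : Fin n → U → U), IsFinAct T p ∧ (∀ x, ψ x ∈ T) ∧
      (∀ t ∈ T, ∃ x, ψ x = t) ∧ ∀ i x, p i (ψ x) = ψ (σ i x) := by
  classical
  obtain ⟨S, hS⟩ := hfin
  have hψ0 : ∀ x y, D x y = 0 → ψ x = ψ y := fun x y h =>
    eq_of_dist_eq_zero (by rw [hψ, h])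
  have hT : ∀ x, ψ x ∈ S.image ψ := fun x => by
    obtain ⟨s, hs, h⟩ := hS x
    rw [hψ0 x s h]
    exact Finset.mem_image_of_mem _ hs
  have hT' : ∀ t ∈ S.image ψ, ∃ x, ψ x = t := fun t ht => by
    obtain ⟨x, -, hx⟩ := Finset.mem_image.1 ht
    exact ⟨x, hx⟩
  let p : Fin n → U → U := fun i t => if h : ∃ x, ψ x = t then ψ (σ i h.choose) else t
  have hp : ∀ i x, p i (ψ x) = ψ (σ i x) := fun i x => by
    have h : ∃ y, ψ y = ψ x := ⟨x, rfl⟩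
    have h1 : p i (ψ x) = ψ (σ i h.choose) := dif_pos h
    rw [h1]
    exact hψ0 _ _ (by rw [hσ, ← hψ, h.choose_spec, dist_self])
  refine ⟨S.image ψ, p, ⟨fun i t ht => ?_, fun i s hs t ht => ?_, fun i j t ht => ?_⟩, hT, hT', hp⟩
  · obtain ⟨x, rfl⟩ := hT' t ht
    rw [hp]
    exact hT _
  · obtain ⟨x, rfl⟩ := hT' t ht
    obtain ⟨y, rfl⟩ := hT' s hs
    rw [hp, hp, hψ, hψ, hσ]
  · obtain ⟨x, rfl⟩ := hT' t ht
    rw [hp, hp, hp, hp, hcomm]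

/-- Amalgamation of finite sets with commuting self-isometries over a common part. -/
theorem IsFinAct.exists_amalgam (hU : IsRationalUrysohn U) {n : ℕ} {F T Y : Finset U}
    {p r : Fin n → U → U} (hT : IsFinAct T p) (hY : IsFinAct Y r) (hFT : F ⊆ T) (hFY : F ⊆ Y)
    (hF : ∀ i, ∀ a ∈ F, p i a = r i a ∧ p i a ∈ F) :
    ∃ (W : Finset U) (s : Fin n → U → U) (h : U ≃ᵢ U), IsFinAct W s ∧ Y ⊆ W ∧
      (∀ i, ∀ y ∈ Y, s i y = r i y) ∧ (∀ a ∈ F, h a = a) ∧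
      ∀ t ∈ T, h t ∈ W ∧ ∀ i, s i (h t) = h (p i t) := by
  classical
  let u : T ⊕ Y → U := Sum.elim Subtype.val Subtype.val
  let lab : T ⊕ Y → Bool := Sum.isLeft
  obtain ⟨D, hD, hlab, h0, hinv⟩ := exists_freeAmalgam hU u lab (fun _ (a : F) => (a : U))
    (fun a b => dist (a : U) b) (fun _ _ _ => rfl)
  let σ : Fin n → T ⊕ Y → T ⊕ Y := fun i =>
    Sum.map (fun t => ⟨p i t, hT.maps i t t.2⟩) (fun y => ⟨r i y, hY.maps i y y.2⟩)
  have hσ : ∀ i x y, D (σ i x) (σ i y) = D x y := by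
    intro i
    refine hinv (σ i) (fun a => ⟨p i a, (hF i a a.2).2⟩) ?_ ?_ ?_ ?_
    · intro b
      obtain ⟨a, ha, hab⟩ := exists_mem_eq_of_isometry (fun a ha => (hF i a ha).2)
        (fun a ha b hb => hT.dist_eq i a (hFT ha) b (hFT hb)) b.2
      exact ⟨⟨a, ha⟩, Subtype.ext hab⟩
    · rintro (x | x) (y | y) <;> simp [lab, σ]
    · rintro (x | x) (y | y) h
      · exact hT.dist_eq i x x.2 y y.2
      · cases h
      · cases h
      · exact hY.dist_eq i x x.2 y y.2
    · rintro (x | x) a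
      · exact hT.dist_eq i x x.2 a (hFT a.2)
      · change dist (r i x) (p i a) = dist (x : U) a
        rw [(hF i a a.2).1]
        exact hY.dist_eq i x x.2 a (hFY a.2)
  have hcomm : ∀ i j x, σ i (σ j x) = σ j (σ i x) := by
    rintro i j (x | x)
    · exact congrArg Sum.inl (Subtype.ext (hT.comm i j x x.2))
    · exact congrArg Sum.inr (Subtype.ext (hY.comm i j x x.2))
  have hfin : ∃ S : Finset (T ⊕ Y), ∀ x, ∃ s ∈ S, D x s = 0 :=
    ⟨Finset.univ, fun x => ⟨x, Finset.mem_univ _, hD.self x⟩⟩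
  -- A default value `x0` is needed for `e` off `Y`; without one, `T` is empty and there is nothing
  -- to amalgamate.
  rcases isEmpty_or_nonempty (T ⊕ Y) with hE | ⟨⟨x0⟩⟩
  · have hT0 : ∀ t, t ∉ T := fun t ht => hE.false (.inl ⟨t, ht⟩)
    exact ⟨Y, r, IsometryEquiv.refl U, hY, subset_rfl, fun _ _ _ => rfl, fun _ _ => rfl,
      fun t ht => absurd ht (hT0 t)⟩
  let e : U → T ⊕ Y := fun y => if hy : y ∈ Y then .inr ⟨y, hy⟩ else x0
  have he : ∀ y (hy : y ∈ Y), e y = .inr ⟨y, hy⟩ := fun y hy => dif_pos hy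
  obtain ⟨ψ, hψ, hψe⟩ := exists_realization hU hD hfin Y e (fun a ha b hb => by
    rw [he a ha, he b hb]; exact hlab _ _ rfl)
  obtain ⟨W, s, hW, hWψ, -, hs⟩ := exists_isFinAct_of_realization hfin hσ hcomm hψ
  obtain ⟨h, hh⟩ := exists_isometryEquiv_extending hU (Y := T)
    (φ := fun t => if ht : t ∈ T then ψ (.inl ⟨t, ht⟩) else t) (by
      intro x hx y hy
      simp only [dif_pos hx, dif_pos hy]
      rw [hψ]; exact hlab _ _ rfl)
  have hh' : ∀ t (ht : t ∈ T), h t = ψ (.inl ⟨t, ht⟩) := fun t ht => by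
    rw [hh t ht, dif_pos ht]
  have hψY : ∀ y (hy : y ∈ Y), ψ (.inr ⟨y, hy⟩) = y := fun y hy => by rw [← he y hy, hψe y hy]
  refine ⟨W, s, h, hW, fun y hy => ?_, fun i y hy => ?_, fun a ha => ?_, fun t ht => ⟨?_, fun i => ?_⟩⟩
  · rw [← hψY y hy]
    exact hWψ _
  · conv_lhs => rw [← hψY y hy]
    rw [hs]
    exact hψY _ (hY.maps i y hy)
  · rw [hh' a (hFT ha)]
    conv_rhs => rw [← hψY a (hFY ha)]
    refine eq_of_dist_eq_zero ?_
    rw [hψ]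
    exact h0 _ _ ⟨a, ha⟩ rfl rfl
  · rw [hh' t ht]
    exact hWψ _
  · rw [hh' t ht, hs, hh' _ (hT.maps i t ht)]
    rfl

/-- If a further self-isometry is given on an invariant part of a finite set with commuting
self-isometries, then the whole can be enlarged so that all of them become total. -/
theorem IsFinAct.exists_total (hU : IsRationalUrysohn U) {n : ℕ} {Y Z : Finset U}
    {z : Fin n → U → U} {f : U → U} (hZ : IsFinAct Z z) (hYZ : Y ⊆ Z)
    (hY : IsFinAct Y (Fin.snoc z f : Fin (n + 1) → U → U)) :
    ∃ (W : Finset U) (s : Fin (n + 1) → U → U), IsFinAct W s ∧ Z ⊆ W ∧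
      (∀ i, ∀ x ∈ Z, s (Fin.castSucc i) x = z i x) ∧ ∀ y ∈ Y, s (Fin.last n) y = f y := by
  classical
  have hzm : ∀ i, ∀ y ∈ Y, z i y ∈ Y := fun i => by
    simpa only [Fin.snoc_castSucc] using hY.maps (Fin.castSucc i)
  have hzd : ∀ i, ∀ a ∈ Y, ∀ b ∈ Y, dist (z i a) (z i b) = dist a b := fun i => by
    simpa only [Fin.snoc_castSucc] using hY.dist_eq (Fin.castSucc i)
  have hfm : ∀ y ∈ Y, f y ∈ Y := by simpa only [Fin.snoc_last] using hY.maps (Fin.last n)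
  have hfd : ∀ a ∈ Y, ∀ b ∈ Y, dist (f a) (f b) = dist a b := by
    simpa only [Fin.snoc_last] using hY.dist_eq (Fin.last n)
  have hfz : ∀ i, ∀ y ∈ Y, f (z i y) = z i (f y) := fun i => by
    simpa only [Fin.snoc_last, Fin.snoc_castSucc] using hY.comm (Fin.last n) (Fin.castSucc i)
  let r : Fin n → Y → Y := fun i y => ⟨z i y, hzm i y y.2⟩
  have hrs : ∀ i, Function.Surjective (r i) := fun i b => by
    obtain ⟨a, ha, hab⟩ := exists_mem_eq_of_isometry (hzm i) (hzd i) b.2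
    exact ⟨⟨a, ha⟩, Subtype.ext hab⟩
  let f' : Equiv.Perm Y := Equiv.ofBijective (fun y => ⟨f y, hfm y y.2⟩)
    (Finite.surjective_iff_bijective.1 fun b => by
      obtain ⟨a, ha, hab⟩ := exists_mem_eq_of_isometry hfm hfd b.2
      exact ⟨⟨a, ha⟩, Subtype.ext hab⟩)
  have hf' : ∀ y, ((f' y : Y) : U) = f y := fun y => rfl
  -- The finite group of isometric automorphisms of `Y` commuting with the action indexes the copies
  -- of `Z`; it contains `f`.
  let ι := {k : Equiv.Perm Y // (∀ a b, dist (k a : U) (k b) = dist (a : U) b) ∧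
    ∀ i a, k (r i a) = r i (k a)}
  let f'' : ι → ι := fun k => ⟨f' * k.1, fun a b => by
      rw [Equiv.Perm.mul_apply, Equiv.Perm.mul_apply, hf', hf', hfd _ (k.1 a).2 _ (k.1 b).2,
        k.2.1], fun i a => by
      rw [Equiv.Perm.mul_apply, Equiv.Perm.mul_apply, k.2.2]
      exact Subtype.ext (hfz i _ (k.1 a).2)⟩
  let one : ι := ⟨1, fun _ _ => rfl, fun _ _ => rfl⟩
  have hinvk : ∀ k : ι, ∀ i a, k.1⁻¹ (r i a) = r i (k.1⁻¹ a) := fun k i a => by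
    rw [Equiv.Perm.inv_eq_iff_eq, k.2.2, Equiv.Perm.coe_inv, Equiv.apply_symm_apply]
  let u : Z × ι → U := fun x => x.1
  -- Copy `k` is glued so that `(y, k)` represents the hub `k y`. Then `(x, k) ↦ (x, f' * k)` moves
  -- the hub `a` to `f' a`, so on the copy with index `one` it restricts to `f` on `Y`.
  obtain ⟨D, hD, hlab, h0, hinv⟩ := exists_freeAmalgam hU u Prod.snd
    (fun k (a : Y) => ((k.1⁻¹ a : Y) : U)) (fun a b => dist (a : U) b) (fun k a b => by
      rw [← k.2.1, Equiv.Perm.coe_inv, Equiv.apply_symm_apply, Equiv.apply_symm_apply])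
  let σ : Fin (n + 1) → Z × ι → Z × ι :=
    Fin.snoc (fun i x => (⟨z i x.1, hZ.maps i x.1 x.1.2⟩, x.2)) fun x => (x.1, f'' x.2)
  have hσ1 : ∀ i, σ (Fin.castSucc i) = fun x => (⟨z i x.1, hZ.maps i x.1 x.1.2⟩, x.2) :=
    fun i => Fin.snoc_castSucc ..
  have hσ2 : σ (Fin.last n) = fun x => (x.1, f'' x.2) := Fin.snoc_last ..
  have hf''inj : ∀ k l, f'' k = f'' l ↔ k = l := fun k l => by
    refine ⟨fun h => Subtype.ext (mul_left_cancel (Subtype.ext_iff.1 h)), fun h => h ▸ rfl⟩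
  have hσ : ∀ i x y, D (σ i x) (σ i y) = D x y := by
    intro i
    refine Fin.lastCases ?_ (fun i => ?_) i
    · rw [hσ2]
      refine hinv _ f' f'.surjective (fun x y => hf''inj _ _) (fun _ _ _ => rfl) fun x a => ?_
      change dist (x.1 : U) ((f' * x.2.1)⁻¹ (f' a) : Y) = _
      rw [mul_inv_rev, Equiv.Perm.mul_apply, Equiv.Perm.coe_inv f', Equiv.symm_apply_apply]
    · rw [hσ1]
      refine hinv _ (r i) (hrs i) (fun x y => Iff.rfl)
        (fun x y _ => hZ.dist_eq i _ x.1.2 _ y.1.2) fun x a => ?_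
      change dist (z i x.1) (x.2.1⁻¹ (r i a) : Y) = _
      rw [hinvk]
      exact hZ.dist_eq i _ x.1.2 _ (hYZ (x.2.1⁻¹ a).2)
  have hcomm : ∀ i j x, σ i (σ j x) = σ j (σ i x) := by
    intro i j x
    refine Fin.lastCases ?_ (fun i => ?_) i <;> refine Fin.lastCases ?_ (fun j => ?_) j
    · rfl
    · rw [hσ1, hσ2]
    · rw [hσ1, hσ2]
    · rw [hσ1, hσ1]
      exact Prod.ext (Subtype.ext (hZ.comm i j _ x.1.2)) rfl
  have hfin : ∃ S : Finset (Z × ι), ∀ x, ∃ s ∈ S, D x s = 0 := by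
    have := Fintype.ofFinite (Z × ι)
    exact ⟨Finset.univ, fun x => ⟨x, Finset.mem_univ _, hD.self x⟩⟩
  rcases Z.eq_empty_or_nonempty with rfl | ⟨z0, hz0⟩
  · obtain rfl : Y = ∅ := Finset.subset_empty.1 hYZ
    exact ⟨∅, Fin.snoc z f, hY, subset_rfl, by simp, by simp⟩
  let e : U → Z × ι := fun x => if hx : x ∈ Z then (⟨x, hx⟩, one) else (⟨z0, hz0⟩, one)
  have he : ∀ x (hx : x ∈ Z), e x = (⟨x, hx⟩, one) := fun x hx => dif_pos hx
  obtain ⟨ψ, hψ, hψe⟩ := exists_realization hU hD hfin Z e (fun a ha b hb => by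
    rw [he a ha, he b hb]; exact hlab _ _ rfl)
  obtain ⟨W, s, hW, hWψ, -, hs⟩ := exists_isFinAct_of_realization hfin hσ hcomm hψ
  have hψZ : ∀ x (hx : x ∈ Z), ψ (⟨x, hx⟩, one) = x := fun x hx => by rw [← he x hx, hψe x hx]
  refine ⟨W, s, hW, fun x hx => ?_, fun i x hx => ?_, fun y hy => ?_⟩
  · rw [← hψZ x hx]
    exact hWψ _
  · conv_lhs => rw [← hψZ x hx]
    rw [hs, hσ1]
    exact hψZ _ (hZ.maps i x hx)
  · conv_lhs => rw [← hψZ y (hYZ hy)]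
    rw [hs, hσ2, ← hψZ (f y) (hYZ (hfm y hy))]
    refine eq_of_dist_eq_zero ?_
    rw [hψ]
    refine h0 _ _ (f' ⟨y, hy⟩) ?_ rfl
    change y = (((f' * 1)⁻¹ (f' ⟨y, hy⟩) : Y) : U)
    rw [mul_one, Equiv.Perm.coe_inv, Equiv.symm_apply_apply]

/-! ### Separation of points from orbits by subgroups of finite index. -/

section Separation

theorem isOfFinOrder_multiplicative_addCircle (x : Multiplicative (AddCircle (1 : ℚ))) :
    IsOfFinOrder x := by
  obtain ⟨q, hq⟩ := QuotientAddGroup.mk_surjective (Multiplicative.toAdd x)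
  rw [isOfFinOrder_iff_pow_eq_one]
  refine ⟨q.den, q.den_pos, ?_⟩
  apply Multiplicative.toAdd.injective
  rw [toAdd_pow, ← hq, toAdd_one]
  change ((q.den • q : ℚ) : AddCircle (1 : ℚ)) = 0
  rw [AddCircle.coe_eq_zero_iff]
  exact ⟨q.num, by rw [zsmul_one, nsmul_eq_mul, Rat.den_mul_eq_num]⟩

/-- In a finitely generated commutative group every subgroup is an intersection of subgroups of
finite index. -/
theorem exists_finiteIndex_notMem {Γ : Type*} [CommGroup Γ] [Group.FG Γ] (P : Subgroup Γ) {γ : Γ}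
    (hγ : γ ∉ P) : ∃ K : Subgroup Γ, K.FiniteIndex ∧ P ≤ K ∧ γ ∉ K := by
  have hne : Additive.ofMul (QuotientGroup.mk' P γ) ≠ 0 := fun h =>
    hγ ((QuotientGroup.eq_one_iff γ).1 (Additive.ofMul.injective h))
  -- A character of `Γ ⧸ P` into `ℚ/ℤ` not killing `γ` has finitely generated torsion image, hence
  -- finite image, so its kernel has finite index.
  obtain ⟨c, hc⟩ := CharacterModule.exists_character_apply_ne_zero_of_ne_zero hne
  let c' : Additive (Γ ⧸ P) →+ AddCircle (1 : ℚ) := c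
  let φ : Γ →* Multiplicative (AddCircle (1 : ℚ)) :=
    (AddMonoidHom.toMultiplicativeRight c').comp (QuotientGroup.mk' P)
  have : Finite φ.range := CommGroup.finite_of_fg_isMulTorsion _
    (IsMulTorsion.subgroup isOfFinOrder_multiplicative_addCircle φ.range)
  refine ⟨φ.ker, inferInstance, fun x hx => ?_, fun h => hc ?_⟩
  · rw [MonoidHom.mem_ker, MonoidHom.comp_apply]
    rw [show QuotientGroup.mk' P x = 1 from (QuotientGroup.eq_one_iff x).2 hx, map_one]
  · exact Multiplicative.ofAdd.injective (MonoidHom.mem_ker.1 h)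

variable {Γ X : Type*} [CommGroup Γ] [MulAction Γ X]

variable (Γ) in
/-- Finite unions of orbits of subgroups. -/
inductive IsOrbitUnion : Set X → Prop
  | empty : IsOrbitUnion ∅
  | orbit (P : Subgroup Γ) (u : X) : IsOrbitUnion {x | ∃ γ ∈ P, γ • u = x}
  | union {B C : Set X} : IsOrbitUnion B → IsOrbitUnion C → IsOrbitUnion (B ∪ C)

theorem IsOrbitUnion.biUnion {ι : Type*} (s : Finset ι) (B : ι → Set X)
    (h : ∀ i ∈ s, IsOrbitUnion Γ (B i)) : IsOrbitUnion Γ (⋃ i ∈ s, B i) := by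
  classical
  induction s using Finset.induction_on with
  | empty => simpa using .empty
  | insert i s hi ih =>
    rw [Finset.set_biUnion_insert]
    exact .union (h i (Finset.mem_insert_self i s))
      (ih fun j hj => h j (Finset.mem_insert_of_mem hj))

/-- For `B = P • u` and some `γ₀ • a ∈ B`, commutativity shows that the `γ` with `γ • a ∈ B` form
the coset of `P ⊔ stabilizer a` through `γ₀`. -/
theorem IsOrbitUnion.step {B : Set X} (hB : IsOrbitUnion Γ B) (a b : X) :
    IsOrbitUnion Γ {x | ∃ γ : Γ, γ • a ∈ B ∧ γ • b = x} := by
  induction hB with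
  | empty => simpa using .empty
  | union _ _ h1 h2 =>
    convert h1.union h2 using 1
    ext x
    simp only [Set.mem_ofPred_eq, Set.mem_union]
    constructor
    · rintro ⟨γ, h | h, rfl⟩
      exacts [.inl ⟨γ, h, rfl⟩, .inr ⟨γ, h, rfl⟩]
    · rintro (⟨γ, h, rfl⟩ | ⟨γ, h, rfl⟩)
      exacts [⟨γ, .inl h, rfl⟩, ⟨γ, .inr h, rfl⟩]
  | orbit P u =>
    by_cases h : ∃ γ₀ : Γ, ∃ π₀ ∈ P, π₀ • u = γ₀ • a
    · obtain ⟨γ₀, π₀, hπ₀, h0⟩ := h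
      convert IsOrbitUnion.orbit (P ⊔ MulAction.stabilizer Γ a) (γ₀ • b) using 1
      ext x
      constructor
      · rintro ⟨γ, ⟨π, hπ, h1⟩, rfl⟩
        refine ⟨(π * π₀⁻¹) * (π₀ * π⁻¹ * γ * γ₀⁻¹), ?_, ?_⟩
        · refine Subgroup.mul_mem_sup (P.mul_mem hπ (P.inv_mem hπ₀)) ?_
          rw [MulAction.mem_stabilizer_iff,
            show π₀ * π⁻¹ * γ * γ₀⁻¹ = γ₀⁻¹ * π₀ * π⁻¹ * γ by
              rw [mul_comm _ γ₀⁻¹]; simp only [mul_assoc],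
            mul_smul, ← h1, ← mul_smul, inv_mul_cancel_right, mul_smul, h0, inv_smul_smul]
        · rw [smul_smul]
          congr 1
          group
      · rintro ⟨δ, hδ, rfl⟩
        obtain ⟨π, hπ, s, hs, rfl⟩ := Subgroup.mem_sup.1 hδ
        refine ⟨π * s * γ₀, ⟨π * π₀, P.mul_mem hπ hπ₀, ?_⟩, mul_smul _ _ _⟩
        rw [mul_smul, h0, mul_assoc, mul_smul π, mul_comm s, mul_smul γ₀,
          MulAction.mem_stabilizer_iff.1 hs]
    · convert IsOrbitUnion.empty using 1
      refine Set.eq_empty_of_forall_notMem ?_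
      rintro x ⟨γ, ⟨π, hπ, h1⟩, -⟩
      exact h ⟨γ, π, hπ, h1⟩

/-- If `y = γ • u` avoids `P • u`, then `γ ∉ P ⊔ stabilizer u`, and a finite-index subgroup
containing the latter but not `γ` works. Unions are handled by intersecting subgroups. -/
theorem IsOrbitUnion.exists_finiteIndex [Group.FG Γ] {B : Set X} (hB : IsOrbitUnion Γ B) {y : X}
    (hy : y ∉ B) : ∃ K : Subgroup Γ, K.FiniteIndex ∧ ∀ κ ∈ K, κ • y ∉ B := by
  induction hB with
  | empty => exact ⟨⊤, inferInstance, fun _ _ h => h⟩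
  | union _ _ h1 h2 =>
    obtain ⟨K, hK, h3⟩ := h1 fun h => hy (.inl h)
    obtain ⟨L, hL, h4⟩ := h2 fun h => hy (.inr h)
    exact ⟨K ⊓ L, inferInstance, fun κ hκ h => h.elim (h3 κ hκ.1) (h4 κ hκ.2)⟩
  | orbit P u =>
    by_cases h : ∃ γ : Γ, γ • u = y
    · obtain ⟨γ, rfl⟩ := h
      have hγ : γ ∉ P ⊔ MulAction.stabilizer Γ u := fun h => by
        obtain ⟨π, hπ, s, hs, rfl⟩ := Subgroup.mem_sup.1 h
        exact hy ⟨π, hπ, by rw [mul_smul, MulAction.mem_stabilizer_iff.1 hs]⟩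
      obtain ⟨K, hK, hle, hγK⟩ := exists_finiteIndex_notMem _ hγ
      refine ⟨K, hK, ?_⟩
      rintro κ hκ ⟨π, hπ, h⟩
      apply hγK
      have hs : π⁻¹ * (κ * γ) ∈ K := hle (Subgroup.mem_sup_right (by
        rw [MulAction.mem_stabilizer_iff, mul_smul, mul_smul, ← h, inv_smul_smul]))
      have hπK : π ∈ K := hle (Subgroup.mem_sup_left hπ)
      have := K.mul_mem (K.inv_mem hκ) (K.mul_mem hπK hs)
      rwa [mul_inv_cancel_left, inv_mul_cancel_left] at this
    · refine ⟨⊤, inferInstance, ?_⟩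
      rintro κ - ⟨π, hπ, h'⟩
      exact h ⟨κ⁻¹ * π, by rw [mul_smul, h', inv_smul_smul]⟩

variable (Γ) in
/-- `v` can be reached from `u` along translates of edges between points of `A`, of total weight
`r`. -/
inductive Reach (A : Finset X) (w : X → X → ℕ) : ℕ → X → X → Prop
  | refl (u : X) : Reach A w 0 u u
  | step {r s : ℕ} {u : X} (γ : Γ) {a b : X} : a ∈ A → b ∈ A → a ≠ b → Reach A w r u (γ • a) →
      s = r + w a b → Reach A w s u (γ • b)

section Reach

variable {A : Finset X} {w : X → X → ℕ} {r s : ℕ} {u v x : X}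

theorem Reach.trans (h : Reach Γ A w r u v) (h' : Reach Γ A w s v x) :
    Reach Γ A w (r + s) u x := by
  induction h' with
  | refl => exact h
  | step γ ha hb hab _ hs ih => exact .step γ ha hb hab (ih h) (by omega)

theorem Reach.symm (hw : ∀ a b, w a b = w b a) (h : Reach Γ A w r u v) : Reach Γ A w r v u := by
  induction h with
  | refl => exact .refl _
  | @step r s u γ a b ha hb hab _ hs ih =>
    have h1 : Reach Γ A w (w b a) (γ • b) (γ • a) :=
      .step γ hb ha hab.symm (.refl _) (zero_add _).symm
    rw [hs, hw a b, add_comm]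
    exact h1.trans ih

theorem Reach.smul (γ : Γ) (h : Reach Γ A w r u v) : Reach Γ A w r (γ • u) (γ • v) := by
  induction h with
  | refl => exact .refl _
  | step δ ha hb hab _ hs ih =>
    rw [smul_smul] at ih ⊢
    exact .step _ ha hb hab ih hs

/-- Removing the last edge lowers the total weight, as weights are positive; there are finitely many
edge types, each handled by `IsOrbitUnion.step`. -/
theorem isOrbitUnion_reach (hw : ∀ a ∈ A, ∀ b ∈ A, a ≠ b → 0 < w a b) (u : X) (r : ℕ) :
    IsOrbitUnion Γ {v | Reach Γ A w r u v} := by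
  classical
  induction r using Nat.strong_induction_on with
  | _ r ih =>
  have h1 : IsOrbitUnion Γ {v | r = 0 ∧ v = u} := by
    by_cases hr : r = 0
    · convert IsOrbitUnion.orbit (⊥ : Subgroup Γ) u using 1
      ext v
      simp [hr, eq_comm]
    · convert IsOrbitUnion.empty using 1
      simp [hr]
  have h2 := IsOrbitUnion.biUnion (Γ := Γ)
    ((A ×ˢ A).filter fun p => p.1 ≠ p.2 ∧ w p.1 p.2 ≤ r)
    (fun p => {x | ∃ γ : Γ, γ • p.1 ∈ {v | Reach Γ A w (r - w p.1 p.2) u v} ∧ γ • p.2 = x})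
    (by
      rintro ⟨a, b⟩ hp
      simp only [Finset.mem_filter, Finset.mem_product] at hp
      obtain ⟨⟨ha, hb⟩, hab, hle⟩ := hp
      have := hw a ha b hb hab
      exact (ih (r - w a b) (by omega)).step a b)
  convert h1.union h2 using 1
  ext v
  simp only [Set.mem_ofPred_eq, Set.mem_union, Set.mem_iUnion, Finset.mem_filter,
    Finset.mem_product, exists_prop, Prod.exists]
  constructor
  · rintro (_ | ⟨γ, ha, hb, hab, h, rfl⟩)
    · exact .inl ⟨rfl, rfl⟩
    · refine .inr ⟨_, _, ⟨⟨ha, hb⟩, hab, Nat.le_add_left _ _⟩, γ, ?_, rfl⟩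
      rwa [Nat.add_sub_cancel]
  · rintro (⟨rfl, rfl⟩ | ⟨a, b, ⟨⟨ha, hb⟩, hab, hle⟩, γ, h, rfl⟩)
    · exact .refl _
    · exact .step γ ha hb hab h (by omega)

end Reach

end Separation

/-! ### Finite approximation of commuting isometries. -/

theorem exists_common_denominator (hU : IsRationalUrysohn U) (A : Finset U) :
    ∃ q : ℕ, 0 < q ∧ ∃ w : U → U → ℕ, (∀ a b, w a b = w b a) ∧
      ∀ a ∈ A, ∀ b ∈ A, (w a b : ℝ) = q * dist a b := by
  choose ρ hρ using hU.rational
  -- On `A` the floor changes nothing; elsewhere it merely provides natural numbers symmetric in the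
  -- two points.
  refine ⟨∏ p ∈ A ×ˢ A, (ρ p.1 p.2).den, Finset.prod_pos fun p _ => (ρ p.1 p.2).den_pos,
    fun a b => ⌊((∏ p ∈ A ×ˢ A, (ρ p.1 p.2).den : ℕ) : ℝ) * dist a b⌋₊,
    fun a b => by dsimp only; rw [dist_comm], fun a ha b hb => ?_⟩
  obtain ⟨m, hm⟩ := Finset.dvd_prod_of_mem (fun p : U × U => (ρ p.1 p.2).den)
    (Finset.mk_mem_product ha hb)
  have h0 : 0 ≤ ρ a b := by exact_mod_cast hρ a b ▸ dist_nonneg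
  obtain ⟨k, hk⟩ := Int.eq_ofNat_of_zero_le (Rat.num_nonneg.2 h0)
  have h1 : (((ρ a b).den : ℚ) * ρ a b) = k := by
    rw [Rat.den_mul_eq_num, hk]; simp
  have h2 : ((∏ p ∈ A ×ˢ A, (ρ p.1 p.2).den : ℕ) : ℝ) * dist a b = (m * k : ℕ) := by
    rw [hm, hρ]
    have h3 : (((ρ a b).den : ℝ) * ρ a b) = k := by exact_mod_cast h1
    push_cast
    rw [mul_right_comm, h3, mul_comm]
  dsimp only
  rw [h2, Nat.floor_natCast]

/-- Distances on a finite set are realized by an invariant pseudodistance which is trivial on the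
orbits of a subgroup of finite index. -/
theorem exists_invariant_dist (hU : IsRationalUrysohn U) {Γ : Type*} [CommGroup Γ] [Group.FG Γ]
    [MulAction Γ U] (hiso : ∀ (γ : Γ) (x y : U), dist (γ • x) (γ • y) = dist x y) (A : Finset U) :
    ∃ (K : Subgroup Γ) (D : U → U → ℝ), K.FiniteIndex ∧ IsRatDist D ∧
      (∀ (γ : Γ) x y, D (γ • x) (γ • y) = D x y) ∧ (∀ κ ∈ K, ∀ x, D x (κ • x) = 0) ∧
      ∀ a ∈ A, ∀ b ∈ A, D a b = dist a b := by
  classical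
  obtain ⟨q, hq, w, hws, hw⟩ := exists_common_denominator hU A
  have hq' : (0 : ℝ) < q := by exact_mod_cast hq
  have hpos : ∀ a ∈ A, ∀ b ∈ A, a ≠ b → 0 < w a b := fun a ha b hb hab => by
    have : (0 : ℝ) < w a b := by
      rw [hw a ha b hb]
      exact mul_pos hq' (dist_pos.2 hab)
    exact_mod_cast this
  have hself : ∀ a ∈ A, w a a = 0 := fun a ha => by
    have := hw a ha a ha
    rw [dist_self, mul_zero] at this
    exact_mod_cast this
  obtain ⟨M, hM⟩ : ∃ M, ∀ a ∈ A, ∀ b ∈ A, w a b ≤ M :=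
    ⟨(A ×ˢ A).sup fun p => w p.1 p.2, fun a ha b hb =>
      Finset.le_sup (f := fun p : U × U => w p.1 p.2) (Finset.mk_mem_product ha hb)⟩
  have hlen : ∀ r u v, Reach Γ A w r u v → q * dist u v ≤ r := by
    intro r u v h
    induction h with
    | refl => simp
    | @step r s u γ a b ha hb hab _ hs ih =>
      have h1 := dist_triangle u (γ • a) (γ • b)
      rw [hiso] at h1
      have h2 := mul_le_mul_of_nonneg_left h1 hq'.le
      rw [mul_add, ← hw a ha b hb] at h2
      rw [hs]
      push_cast
      linarith
  -- By `hlen`, no path from `a` to `b` has weight less than `w a b`; separation keeps this true for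
  -- the `K`-translates of `b`, one weight `r` at a time.
  have hsep : ∀ t : U × U × ℕ, ∃ K : Subgroup Γ, K.FiniteIndex ∧ (t.1 ∈ A → t.2.1 ∈ A →
      t.2.2 < w t.1 t.2.1 → ∀ κ ∈ K, ¬ Reach Γ A w t.2.2 t.1 (κ • t.2.1)) := by
    rintro ⟨a, b, r⟩
    by_cases h : a ∈ A ∧ b ∈ A ∧ r < w a b
    · obtain ⟨ha, hb, hr⟩ := h
      obtain ⟨K, hK, h1⟩ := (isOrbitUnion_reach (Γ := Γ) hpos a r).exists_finiteIndex (y := b)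
        fun h => by
          have h2 := hlen _ _ _ h
          rw [← hw a ha b hb] at h2
          exact absurd hr (not_lt.2 (by exact_mod_cast h2))
      exact ⟨K, hK, fun _ _ _ => h1⟩
    · exact ⟨⊤, inferInstance, fun h1 h2 h3 => absurd ⟨h1, h2, h3⟩ h⟩
  choose L hL hLr using hsep
  let K : Subgroup Γ := ⨅ t ∈ A ×ˢ A ×ˢ Finset.range M, L t
  have hK : K.FiniteIndex := Subgroup.finiteIndex_iInf' _ fun t _ => hL t
  -- Path lengths modulo `K`, truncated at `M`. The truncation makes unreachable pairs harmless and,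
  -- since `M` bounds all weights on `A`, it does not affect distances there.
  let S : U → U → Set ℕ := fun u v => {r | M ≤ r ∨ ∃ κ ∈ K, Reach Γ A w r u (κ • v)}
  have hS : ∀ u v, (S u v).Nonempty := fun u v => ⟨M, .inl le_rfl⟩
  have hS0 : ∀ κ ∈ K, ∀ x, sInf (S x (κ • x)) = 0 := fun κ hκ x =>
    Nat.sInf_eq_zero.2 (.inl (.inr ⟨κ⁻¹, K.inv_mem hκ, by rw [inv_smul_smul]; exact .refl _⟩))
  have hSs : ∀ u v, S u v ⊆ S v u := by
    rintro u v r (h | ⟨κ, hκ, h⟩)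
    · exact .inl h
    · refine .inr ⟨κ⁻¹, K.inv_mem hκ, ?_⟩
      have := (h.symm hws).smul κ⁻¹
      rwa [inv_smul_smul] at this
  have hSt : ∀ u v x, ∀ r ∈ S u v, ∀ s ∈ S v x, r + s ∈ S u x := by
    rintro u v x r (h | ⟨κ, hκ, h⟩) s (h' | ⟨κ', hκ', h'⟩)
    · exact .inl (by omega)
    · exact .inl (by omega)
    · exact .inl (by omega)
    · refine .inr ⟨κ * κ', K.mul_mem hκ hκ', ?_⟩
      rw [mul_smul]
      exact h.trans (h'.smul κ)
  have hSγ : ∀ (γ : Γ) u v, S u v ⊆ S (γ • u) (γ • v) := by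
    rintro γ u v r (h | ⟨κ, hκ, h⟩)
    · exact .inl h
    · refine .inr ⟨κ, hκ, ?_⟩
      rw [smul_smul, mul_comm κ, mul_smul]
      exact h.smul γ
  refine ⟨K, fun u v => (sInf (S u v) : ℕ) / q, hK, ⟨fun x => ?_, fun x y => ?_, fun x y z => ?_,
    fun x y => ⟨(sInf (S x y) : ℕ) / q, by push_cast; rfl⟩⟩, fun γ x y => ?_, fun κ hκ x => ?_,
    fun a ha b hb => ?_⟩
  · have := hS0 1 K.one_mem x
    rw [one_smul] at this
    simp [this]
  · rw [(hSs x y).antisymm (hSs y x)]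
  · rw [← add_div]
    gcongr
    exact_mod_cast Nat.sInf_le (hSt x y z _ (Nat.sInf_mem (hS x y)) _ (Nat.sInf_mem (hS y z)))
  · dsimp only
    rw [(hSγ γ x y).antisymm]
    simpa only [inv_smul_smul] using hSγ γ⁻¹ (γ • x) (γ • y)
  · simp [hS0 κ hκ x]
  · rw [div_eq_iff hq'.ne', mul_comm, ← hw a ha b hb]
    congr 1
    apply le_antisymm
    · refine Nat.sInf_le (.inr ⟨1, K.one_mem, ?_⟩)
      by_cases hab : a = b
      · rw [hab, one_smul, hself b hb]
        exact .refl _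
      · refine .step (1 : Γ) ha hb hab ?_ (zero_add _).symm
        rw [one_smul]
        exact .refl _
    · rcases Nat.sInf_mem (hS a b) with h | ⟨κ, hκ, h⟩
      · exact (hM a ha b hb).trans h
      · by_contra! hlt
        refine hLr (a, b, sInf (S a b)) ha hb hlt κ ?_ h
        have hκ' := hκ
        simp only [K, Subgroup.mem_iInf] at hκ'
        exact hκ' _ (Finset.mk_mem_product ha (Finset.mk_mem_product hb
          (Finset.mem_range.2 (hlt.trans_le (hM a ha b hb)))))

/-- The orbits of finitely many points, with the pseudodistance of `exists_invariant_dist`, collapse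
to a finite space on which `Γ` still acts. -/
theorem exists_isFinAct_of_mulAction (hU : IsRationalUrysohn U) {Γ : Type*} [CommGroup Γ]
    [Group.FG Γ] [MulAction Γ U] (hiso : ∀ (γ : Γ) (x y : U), dist (γ • x) (γ • y) = dist x y)
    {n : ℕ} (g : Fin n → Γ) (A : Finset U) :
    ∃ (T : Finset U) (p : Fin n → U → U), IsFinAct T p ∧ A ⊆ T ∧
      ∀ i, ∀ a ∈ A, p i a = g i • a := by
  classical
  rcases A.eq_empty_or_nonempty with rfl | ⟨a0, ha0⟩
  · exact ⟨∅, fun _ => id, ⟨by simp, by simp, by simp⟩, subset_rfl, by simp⟩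
  -- The images of `A` are included so that the realization fixes them too, which gives `p i a = g i
  -- • a`.
  let B : Finset U := A ∪ Finset.univ.biUnion fun i => A.image (g i • ·)
  have hAB : A ⊆ B := Finset.subset_union_left
  have hgB : ∀ i, ∀ a ∈ A, g i • a ∈ B := fun i a ha => Finset.mem_union_right _
    (Finset.mem_biUnion.2 ⟨i, Finset.mem_univ i, Finset.mem_image_of_mem _ ha⟩)
  obtain ⟨K, D, hK, hD, hinv, hDK, hDB⟩ := exists_invariant_dist hU hiso B
  let u : B × Γ → U := fun x => x.2 • (x.1 : U)
  have hD' : IsRatDist fun x y => D (u x) (u y) :=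
    ⟨fun x => hD.self _, fun x y => hD.symm _ _, fun x y z => hD.tri _ _ _, fun x y => hD.rat _ _⟩
  have hfin : ∃ S : Finset (B × Γ), ∀ x, ∃ s ∈ S, D (u x) (u s) = 0 := by
    have := Fintype.ofFinite (Γ ⧸ K)
    refine ⟨Finset.univ ×ˢ Finset.univ.image (Quotient.out : Γ ⧸ K → Γ), fun x =>
      ⟨(x.1, (QuotientGroup.mk x.2 : Γ ⧸ K).out), by simp, ?_⟩⟩
    obtain ⟨κ, hκ⟩ := QuotientGroup.mk_out_eq_mul K x.2
    simp only [u]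
    rw [hκ, mul_comm, mul_smul]
    exact hDK κ κ.2 _
  let e : U → B × Γ := fun b => if hb : b ∈ B then (⟨b, hb⟩, 1) else (⟨a0, hAB ha0⟩, 1)
  have he : ∀ b (hb : b ∈ B), e b = (⟨b, hb⟩, 1) := fun b hb => dif_pos hb
  have hue : ∀ b ∈ B, u (e b) = b := fun b hb => by
    rw [he b hb]
    exact one_smul _ _
  obtain ⟨ψ, hψ, hψe⟩ := exists_realization hU hD' hfin B e fun a ha b hb => by
    rw [hue a ha, hue b hb, hDB a ha b hb]
  let σ : Fin n → B × Γ → B × Γ := fun i x => (x.1, g i * x.2)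
  have huσ : ∀ i x, u (σ i x) = g i • u x := fun i x => mul_smul _ _ _
  obtain ⟨T, p, hT, hψT, -, hp⟩ := exists_isFinAct_of_realization hfin (σ := σ)
    (fun i x y => by rw [huσ, huσ, hinv])
    (fun i j x => Prod.ext rfl (mul_left_comm _ _ _)) hψ
  refine ⟨T, p, hT, fun a ha => ?_, fun i a ha => ?_⟩
  · rw [← hψe a (hAB ha)]
    exact hψT _
  · conv_lhs => rw [← hψe a (hAB ha)]
    rw [hp, ← hψe _ (hgB i a ha)]
    refine eq_of_dist_eq_zero ?_
    rw [hψ, huσ, hue a (hAB ha), hue _ (hgB i a ha), hD.self]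

open scoped IsMulCommutative in
/-- Commuting isometries of `U` agree on any given finite set with commuting isometries of a finite
subset. -/
theorem exists_isFinAct_of_commute (hU : IsRationalUrysohn U) {n : ℕ} (g : Fin n → U ≃ᵢ U)
    (hg : ∀ i j, g i * g j = g j * g i) (A : Finset U) :
    ∃ (T : Finset U) (p : Fin n → U → U), IsFinAct T p ∧ A ⊆ T ∧ ∀ i, ∀ a ∈ A, p i a = g i a := by
  have := Subgroup.isMulCommutative_closure (k := Set.range g) (by
    rintro _ ⟨i, rfl⟩ _ ⟨j, rfl⟩
    exact hg i j)
  let _ : MulAction (Subgroup.closure (Set.range g)) U :=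
    { smul := fun γ x => γ.1 x
      one_smul := fun _ => rfl
      mul_smul := fun _ _ _ => rfl }
  exact exists_isFinAct_of_mulAction hU (fun γ x y => γ.1.dist_eq x y)
    (fun i => (⟨g i, Subgroup.subset_closure ⟨i, rfl⟩⟩ : Subgroup.closure (Set.range g))) A

/-! ### Universal tuples: uniqueness up to conjugacy and prolongation. -/

theorem IsFinAct.congr {n : ℕ} {T : Finset U} {p r : Fin n → U → U} (hT : IsFinAct T p)
    (h : ∀ i, ∀ t ∈ T, r i t = p i t) : IsFinAct T r where
  maps i t ht := by rw [h i t ht]; exact hT.maps i t ht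
  dist_eq i s hs t ht := by rw [h i t ht, h i s hs]; exact hT.dist_eq i s hs t ht
  comm i j t ht := by
    rw [h j t ht, h i t ht, h i _ (hT.maps j t ht), h j _ (hT.maps i t ht)]
    exact hT.comm i j t ht

theorem IsFinAct.map [DecidableEq U] {n : ℕ} {T : Finset U} {p : Fin n → U → U} (hT : IsFinAct T p)
    (k : U ≃ᵢ U) : IsFinAct (T.image k) fun i x => k (p i (k.symm x)) where
  maps i t ht := by
    rw [Finset.mem_image] at ht
    obtain ⟨t, ht, rfl⟩ := ht
    rw [k.symm_apply_apply]
    exact Finset.mem_image_of_mem _ (hT.maps i t ht)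
  dist_eq i s hs t ht := by
    rw [Finset.mem_image] at ht
    obtain ⟨t, ht, rfl⟩ := ht
    rw [Finset.mem_image] at hs
    obtain ⟨s, hs, rfl⟩ := hs
    rw [k.symm_apply_apply, k.symm_apply_apply, k.dist_eq, k.dist_eq]
    exact hT.dist_eq i s hs t ht
  comm i j t ht := by
    rw [Finset.mem_image] at ht
    obtain ⟨t, ht, rfl⟩ := ht
    simp only [k.symm_apply_apply]
    rw [hT.comm i j t ht]

theorem isFinAct_of_commute {n : ℕ} {g : Fin n → U ≃ᵢ U} (hg : ∀ i j, g i * g j = g j * g i)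
    {T : Finset U} (hT : ∀ i, ∀ t ∈ T, g i t ∈ T) : IsFinAct T fun i => g i where
  maps := hT
  dist_eq i s _ t _ := (g i).dist_eq s t
  comm i j t _ := DFunLike.congr_fun (hg i j) t

/-- A commuting tuple of isometries with finite orbits into which all finite extensions of finite
invariant subsets embed. -/
structure IsUniversalTuple {n : ℕ} (g : Fin n → U ≃ᵢ U) : Prop where
  comm : ∀ i j, g i * g j = g j * g i
  exists_invariant_mem : ∀ x, ∃ T : Finset U, x ∈ T ∧ ∀ i, ∀ t ∈ T, g i t ∈ T
  extend : ∀ (F T : Finset U) (p : Fin n → U → U), F ⊆ T → IsFinAct T p →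
    (∀ i, ∀ a ∈ F, p i a = g i a ∧ p i a ∈ F) →
    ∃ h : U ≃ᵢ U, (∀ a ∈ F, h a = a) ∧ ∀ i, ∀ t ∈ T, g i (h t) = h (p i t)

theorem isUniversalTuple_zero (g : Fin 0 → U ≃ᵢ U) : IsUniversalTuple g where
  comm i := i.elim0
  exists_invariant_mem x := ⟨{x}, Finset.mem_singleton_self x, fun i => i.elim0⟩
  extend _ _ _ _ _ _ := ⟨IsometryEquiv.refl U, fun _ _ => rfl, fun i => i.elim0⟩

namespace IsUniversalTuple

variable {n : ℕ} {g g' : Fin n → U ≃ᵢ U}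

theorem exists_invariant (hg : IsUniversalTuple g) (A : Finset U) :
    ∃ T : Finset U, A ⊆ T ∧ ∀ i, ∀ t ∈ T, g i t ∈ T := by
  classical
  choose S hS hSg using hg.exists_invariant_mem
  refine ⟨A.biUnion S, fun a ha => Finset.mem_biUnion.2 ⟨a, ha, hS a⟩, fun i t ht => ?_⟩
  obtain ⟨a, ha, hat⟩ := Finset.mem_biUnion.1 ht
  exact Finset.mem_biUnion.2 ⟨a, ha, hSg a i t hat⟩

theorem conj (hg : IsUniversalTuple g) (k : U ≃ᵢ U) :
    IsUniversalTuple fun i => k * g i * k⁻¹ := by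
  classical
  refine ⟨fun i j => ?_, fun x => ?_, fun F T p hFT hT hF => ?_⟩
  · simp only [mul_assoc, inv_mul_cancel_left]
    rw [← mul_assoc (g i), ← mul_assoc (g j), hg.comm]
  · obtain ⟨T, hxT, hT⟩ := hg.exists_invariant_mem (k.symm x)
    refine ⟨T.image k, Finset.mem_image.2 ⟨_, hxT, k.apply_symm_apply x⟩, fun i t ht => ?_⟩
    rw [Finset.mem_image] at ht
    obtain ⟨t, ht, rfl⟩ := ht
    change k (g i (k.symm (k t))) ∈ _
    rw [k.symm_apply_apply]
    exact Finset.mem_image_of_mem _ (hT i t ht)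
  · obtain ⟨h, hhF, hh⟩ := hg.extend (F.image k.symm) (T.image k.symm) _
      (Finset.image_subset_image hFT) (hT.map k.symm) (by
        intro i a ha
        rw [Finset.mem_image] at ha
        obtain ⟨a, ha, rfl⟩ := ha
        have h1 : p i a = k (g i (k.symm a)) := (hF i a ha).1
        rw [k.symm_symm, k.apply_symm_apply]
        exact ⟨by rw [h1, k.symm_apply_apply], Finset.mem_image_of_mem _ (hF i a ha).2⟩)
    refine ⟨k * h * k⁻¹, fun a ha => ?_, fun i t ht => ?_⟩
    · change k (h (k.symm a)) = a
      rw [hhF _ (Finset.mem_image_of_mem _ ha), k.apply_symm_apply]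
    · change k (g i (k.symm (k (h (k.symm t))))) = k (h (k.symm (p i t)))
      rw [k.symm_apply_apply, hh i _ (Finset.mem_image_of_mem _ ht), k.symm_symm,
        k.apply_symm_apply]

/-- Any two universal tuples of the same length are conjugate. -/
theorem exists_conj_eq (hU : IsRationalUrysohn U) (hg : IsUniversalTuple g)
    (hg' : IsUniversalTuple g') : ∃ k : U ≃ᵢ U, ∀ i, k * g i * k⁻¹ = g' i := by
  classical
  have := hU.countable
  obtain ⟨k, -, -, hk⟩ := exists_isometryEquiv_of_backAndForth (ι := Empty)
    (fun Y φ => (∀ x ∈ Y, ∀ y ∈ Y, dist (φ x) (φ y) = dist x y) ∧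
      ∀ i, ∀ y ∈ Y, g i y ∈ Y ∧ φ (g i y) = g' i (φ y)) (fun _ _ h => h.1)
    (by
      rintro Y φ ⟨hφ, hY⟩ x
      obtain ⟨k, hk⟩ := exists_isometryEquiv_extending hU hφ
      obtain ⟨T, hYT, hT⟩ := hg.exists_invariant (insert x Y)
      -- Transported by `k`, the action of `g` on `T` extends that of `g'` on `φ(Y)`; universality
      -- of `g'` realizes it over `φ(Y)`.
      obtain ⟨h, hhF, hh⟩ := hg'.extend (Y.image k) (T.image k) _
        (Finset.image_subset_image ((Finset.subset_insert x Y).trans hYT))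
        ((isFinAct_of_commute hg.comm hT).map k) (by
          intro i a ha
          rw [Finset.mem_image] at ha
          obtain ⟨a, ha, rfl⟩ := ha
          rw [k.symm_apply_apply]
          obtain ⟨h1, h2⟩ := hY i a ha
          exact ⟨by rw [hk a ha, hk _ h1, h2], Finset.mem_image_of_mem _ h1⟩)
      refine ⟨T, fun t => h (k t), ⟨fun x _ y _ => by rw [h.dist_eq, k.dist_eq], fun i t ht =>
        ⟨hT i t ht, ?_⟩⟩, (Finset.subset_insert x Y).trans hYT, fun y hy => ?_,
        hYT (Finset.mem_insert_self x Y)⟩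
      · rw [hh i _ (Finset.mem_image_of_mem _ ht), k.symm_apply_apply]
      · dsimp only
        rw [hhF _ (Finset.mem_image_of_mem _ hy), hk y hy])
    (by
      rintro Y φ ⟨hφ, hY⟩ x
      obtain ⟨k, hk⟩ := exists_isometryEquiv_extending hU hφ
      obtain ⟨T, hYT, hT⟩ := hg'.exists_invariant (insert x (Y.image k))
      have hYT' : Y ⊆ T.image k.symm := fun y hy => Finset.mem_image.2
        ⟨k y, hYT (Finset.mem_insert_of_mem (Finset.mem_image_of_mem _ hy)), k.symm_apply_apply y⟩
      obtain ⟨h, hhF, hh⟩ := hg.extend Y (T.image k.symm) _ hYT'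
        ((isFinAct_of_commute hg'.comm hT).map k.symm) (by
          intro i a ha
          obtain ⟨h1, h2⟩ := hY i a ha
          have h3 : k.symm (g' i (k.symm.symm a)) = g i a := by
            rw [k.symm_symm, hk a ha, ← h2, ← hk _ h1, k.symm_apply_apply]
          exact ⟨h3, h3 ▸ h1⟩)
      have hh' : ∀ i, ∀ t ∈ T, g i (h (k.symm t)) = h (k.symm (g' i t)) := fun i t ht => by
        rw [hh i _ (Finset.mem_image_of_mem _ ht), k.symm_symm, k.apply_symm_apply]
      refine ⟨T.image fun t => h (k.symm t), fun z => k (h.symm z),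
        ⟨fun x _ y _ => by rw [k.dist_eq, h.symm.dist_eq], ?_⟩, fun y hy => ?_, fun y hy => ?_,
        h (k.symm x), Finset.mem_image_of_mem _ (hYT (Finset.mem_insert_self _ _)), ?_⟩
      · intro i z hz
        obtain ⟨t, ht, rfl⟩ := Finset.mem_image.1 hz
        rw [hh' i t ht]
        refine ⟨Finset.mem_image_of_mem (fun t => h (k.symm t)) (hT i t ht), ?_⟩
        simp only [h.symm_apply_apply, k.apply_symm_apply]
      · exact Finset.mem_image.2 ⟨k y, hYT (Finset.mem_insert_of_mem
          (Finset.mem_image_of_mem _ hy)), by rw [k.symm_apply_apply, hhF y hy]⟩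
      · conv_lhs => rw [← hhF y hy]
        dsimp only
        rw [h.symm_apply_apply, hk y hy]
      · dsimp only
        rw [h.symm_apply_apply, k.apply_symm_apply])
    (fun i => i.elim) (fun i => i.elim) (Y := ∅) (φ := id) ⟨by simp, by simp⟩
  refine ⟨k, fun i => IsometryEquiv.ext fun x => ?_⟩
  obtain ⟨Z, χ, ⟨-, hZ⟩, hxZ, hχ⟩ := hk (k.symm x)
  change k (g i (k.symm x)) = g' i x
  obtain ⟨h1, h2⟩ := hZ i _ hxZ
  rw [hχ _ h1, h2, ← hχ _ hxZ, k.apply_symm_apply]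

/-- Universality applied to the first `n` maps of `s` moves `W` so that they become `g`; the last
map is carried along. -/
theorem exists_snoc_of_extension [DecidableEq U] (hg : IsUniversalTuple g) {F W : Finset U}
    {s : Fin (n + 1) → U → U} (hW : IsFinAct W s) (hFW : F ⊆ W)
    (hF : ∀ i, ∀ a ∈ F, s (Fin.castSucc i) a = g i a ∧ g i a ∈ F) :
    ∃ h : U ≃ᵢ U, (∀ a ∈ F, h a = a) ∧ ∃ χ : U → U,
      IsFinAct (W.image h) (Fin.snoc (fun i => ⇑(g i)) χ : Fin (n + 1) → U → U) ∧
      ∀ i, ∀ w ∈ W, (Fin.snoc (fun i => ⇑(g i)) χ : Fin (n + 1) → U → U) i (h w) = h (s i w) := by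
  obtain ⟨h, hhF, hh⟩ := hg.extend F W (fun i => s (Fin.castSucc i)) hFW
    ⟨fun i => hW.maps _, fun i => hW.dist_eq _, fun i j => hW.comm _ _⟩
    fun i a ha => ⟨(hF i a ha).1, (hF i a ha).1 ▸ (hF i a ha).2⟩
  have key : ∀ i, ∀ w ∈ W, (Fin.snoc (fun i => ⇑(g i)) (fun x => h (s (Fin.last n) (h.symm x))) :
      Fin (n + 1) → U → U) i (h w) = h (s i w) := by
    intro i w hw
    refine Fin.lastCases ?_ (fun i => ?_) i
    · rw [Fin.snoc_last, h.symm_apply_apply]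
    · rw [Fin.snoc_castSucc, hh i w hw]
  refine ⟨h, hhF, _, (hW.map h).congr fun i x hx => ?_, key⟩
  obtain ⟨w, hw, rfl⟩ := Finset.mem_image.1 hx
  rw [key i w hw, h.symm_apply_apply]

theorem coe_snoc (g : Fin n → U ≃ᵢ U) (f : U ≃ᵢ U) (i : Fin (n + 1)) (x : U) :
    (Fin.snoc g f : Fin (n + 1) → U ≃ᵢ U) i x =
      (Fin.snoc (fun i => ⇑(g i)) ⇑f : Fin (n + 1) → U → U) i x := by
  refine Fin.lastCases ?_ (fun i => ?_) i
  · rw [Fin.snoc_last, Fin.snoc_last]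
  · rw [Fin.snoc_castSucc, Fin.snoc_castSucc]

theorem snoc_congr {f f' : U → U} {x : U} (h : f x = f' x) (i : Fin (n + 1)) :
    (Fin.snoc (fun i => ⇑(g i)) f : Fin (n + 1) → U → U) i x =
      (Fin.snoc (fun i => ⇑(g i)) f' : Fin (n + 1) → U → U) i x := by
  refine Fin.lastCases ?_ (fun i => ?_) i
  · rw [Fin.snoc_last, Fin.snoc_last, h]
  · rw [Fin.snoc_castSucc, Fin.snoc_castSucc]

/-- A self-isometry of a finite invariant set commuting with a universal tuple extends to an
isometry which prolongs the tuple to a universal one. -/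
theorem exists_snoc (hU : IsRationalUrysohn U) (hg : IsUniversalTuple g) {Y : Finset U} {f : U → U}
    (hY : IsFinAct Y (Fin.snoc (fun i => ⇑(g i)) f : Fin (n + 1) → U → U)) :
    ∃ f' : U ≃ᵢ U, (∀ y ∈ Y, f' y = f y) ∧
      IsUniversalTuple (Fin.snoc g f' : Fin (n + 1) → U ≃ᵢ U) := by
  classical
  have := hU.countable
  let G : (U → U) → Fin (n + 1) → U → U := fun χ => Fin.snoc (fun i => ⇑(g i)) χ
  have hG1 : ∀ χ i x, G χ (Fin.castSucc i) x = g i x := fun χ i x => by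
    simp only [G, Fin.snoc_castSucc]
  have hG2 : ∀ χ x, G χ (Fin.last n) x = χ x := fun χ x => by simp only [G, Fin.snoc_last]
  -- The last map is first made total on an abstract enlargement of an invariant set containing `Y ∪
  -- A`; universality of `g` then brings the enlargement back over that set.
  have forth : ∀ Y φ, IsFinAct Y (G φ) → ∀ A : Finset U, ∃ Z χ, IsFinAct Z (G χ) ∧ Y ⊆ Z ∧
      (∀ y ∈ Y, χ y = φ y) ∧ A ⊆ Z := by
    intro Y φ hY A
    obtain ⟨Z, hYZ, hZ⟩ := hg.exists_invariant (Y ∪ A)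
    obtain ⟨W, s, hW, hZW, hs1, hs2⟩ := (isFinAct_of_commute hg.comm hZ).exists_total hU
      (Finset.subset_union_left.trans hYZ) hY
    obtain ⟨h, hh, χ, hχ, hχs⟩ := hg.exists_snoc_of_extension hW hZW
      fun i a ha => ⟨hs1 i a ha, hZ i a ha⟩
    have hsub : Z ⊆ W.image h := fun z hz => Finset.mem_image.2 ⟨z, hZW hz, hh z hz⟩
    refine ⟨W.image h, χ, hχ, (Finset.subset_union_left.trans hYZ).trans hsub, fun y hy => ?_,
      (Finset.subset_union_right.trans hYZ).trans hsub⟩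
    have hyZ := hYZ (Finset.mem_union_left _ hy)
    have h1 := hχs (Fin.last n) y (hZW hyZ)
    rw [hs2 y hy, hh y hyZ] at h1
    have h2 := hY.maps (Fin.last n) y hy
    rw [hG2] at h2
    rw [hh _ (hYZ (Finset.mem_union_left _ h2))] at h1
    exact (hG2 χ y).symm.trans h1
  -- Extension problems `(T, F, p)` with `p` recorded only on `T`, so that there are countably many.
  -- The values of `P` off `T` are immaterial.
  let ι := Σ T : Finset U, Finset U × (Fin (n + 1) → T → U)
  let P : ∀ k : ι, Fin (n + 1) → U → U := fun k i x => if h : x ∈ k.1 then k.2.2 i ⟨x, h⟩ else x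
  obtain ⟨f', hf'Y, hf'T, hf'x⟩ := exists_isometryEquiv_of_backAndForth (ι := ι)
    (fun Y φ => IsFinAct Y (G φ))
    (fun Y φ h x hx y hy => by simpa only [hG2] using h.dist_eq (Fin.last n) x hx y hy)
    (fun Y φ h x => by
      obtain ⟨Z, χ, h1, h2, h3, h4⟩ := forth Y φ h {x}
      exact ⟨Z, χ, h1, h2, h3, h4 (Finset.mem_singleton_self x)⟩)
    (fun Y φ h x => by
      obtain ⟨Z, χ, h1, h2, h3, h4⟩ := forth Y φ h {x}
      refine ⟨Z, χ, h1, h2, h3, exists_mem_eq_of_isometry ?_ ?_ (h4 (Finset.mem_singleton_self x))⟩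
      · simpa only [hG2] using h1.maps (Fin.last n)
      · simpa only [hG2] using h1.dist_eq (Fin.last n))
    (fun k Z χ => k.2.1 ⊆ k.1 → IsFinAct k.1 (P k) → k.2.1 ⊆ Z ∧
      ((∀ i, ∀ a ∈ k.2.1, P k i a = G χ i a ∧ P k i a ∈ k.2.1) → ∃ h : U ≃ᵢ U,
        (∀ a ∈ k.2.1, h a = a) ∧ ∀ t ∈ k.1, h t ∈ Z ∧ ∀ i, G χ i (h t) = h (P k i t)))
    (by
      intro k Y φ hY
      obtain ⟨Z, χ, hZ, hYZ, hχφ, hFZ⟩ := forth Y φ hY k.2.1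
      by_cases hk : k.2.1 ⊆ k.1 ∧ IsFinAct k.1 (P k) ∧
        ∀ i, ∀ a ∈ k.2.1, P k i a = G χ i a ∧ P k i a ∈ k.2.1
      · obtain ⟨h1, h2, h3⟩ := hk
        -- The problem is solved by amalgamating `T` with the current stage `Z` over `F`, then
        -- realizing the amalgam over `Z` without changing `g`.
        obtain ⟨W, s, h, hW, hZW, hs, hhF, hh⟩ := h2.exists_amalgam hU hZ h1 hFZ h3
        obtain ⟨h', hh'Z, χ', hχ', hχ's⟩ := hg.exists_snoc_of_extension hW hZW fun i a ha => by
          have h4 := hZ.maps (Fin.castSucc i) a ha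
          rw [hG1] at h4
          exact ⟨by rw [hs _ a ha, hG1], h4⟩
        have hsub : Z ⊆ W.image h' := fun z hz => Finset.mem_image.2 ⟨z, hZW hz, hh'Z z hz⟩
        refine ⟨W.image h', χ', hχ', hYZ.trans hsub, fun y hy => ?_, fun _ _ =>
          ⟨hFZ.trans hsub, fun _ => ⟨h' * h, fun a ha => ?_, fun t ht => ⟨?_, fun i => ?_⟩⟩⟩⟩
        · have h4 := hχ's (Fin.last n) y (hZW (hYZ hy))
          have h5 := hZ.maps (Fin.last n) y (hYZ hy)
          rw [hG2] at h5
          rw [hs _ y (hYZ hy), hG2, hh'Z y (hYZ hy), hh'Z _ h5] at h4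
          rw [← hχφ y hy, ← h4]
          exact (hG2 χ' y).symm
        · change h' (h a) = a
          rw [hhF a ha, hh'Z a (hFZ ha)]
        · exact Finset.mem_image_of_mem _ (hh t ht).1
        · change G χ' i (h' (h t)) = h' (h (P k i t))
          rw [← (hh t ht).2 i]
          exact hχ's i _ (hh t ht).1
      · exact ⟨Z, χ, hZ, hYZ, hχφ, fun h1 h2 => ⟨hFZ, fun h3 => absurd ⟨h1, h2, h3⟩ hk⟩⟩)
    hY
  refine ⟨f', hf'Y, ?_, fun x => ?_, fun F T p hFT hT hF => ?_⟩
  · have key : ∀ i, g i * f' = f' * g i := fun i => IsometryEquiv.ext fun x => by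
      obtain ⟨Z, χ, hZ, hxZ, hχ⟩ := hf'x x
      have h1 := hZ.comm (Fin.castSucc i) (Fin.last n) x hxZ
      have h2 := hZ.maps (Fin.castSucc i) x hxZ
      rw [hG1, hG2, hG2, hG1] at h1
      rw [hG1] at h2
      change g i (f' x) = f' (g i x)
      rw [hχ x hxZ, hχ _ h2, h1]
    intro i j
    refine Fin.lastCases ?_ (fun i => ?_) i <;> refine Fin.lastCases ?_ (fun j => ?_) j
    · rfl
    · rw [Fin.snoc_last, Fin.snoc_castSucc, key]
    · rw [Fin.snoc_last, Fin.snoc_castSucc, key]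
    · rw [Fin.snoc_castSucc, Fin.snoc_castSucc, hg.comm]
  · obtain ⟨Z, χ, hZ, hxZ, hχ⟩ := hf'x x
    refine ⟨Z, hxZ, fun i t ht => ?_⟩
    rw [coe_snoc, snoc_congr (hχ t ht)]
    exact hZ.maps i t ht
  · let k : ι := ⟨T, F, fun i t => p i t⟩
    have hP : ∀ i, ∀ t ∈ T, P k i t = p i t := fun i t ht => dif_pos ht
    obtain ⟨Z, χ, hZ, hk, hχ⟩ := hf'T k
    obtain ⟨hFZ, h1⟩ := hk hFT (hT.congr hP)
    obtain ⟨h, hhF, hh⟩ := h1 fun i a ha => by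
      rw [hP i a (hFT ha)]
      refine ⟨?_, (hF i a ha).2⟩
      rw [(hF i a ha).1, coe_snoc, snoc_congr (hχ a (hFZ ha))]
    refine ⟨h, hhF, fun i t ht => ?_⟩
    rw [coe_snoc, snoc_congr (hχ _ (hh t ht).1), ← hP i t ht]
    exact (hh t ht).2 i

end IsUniversalTuple

/-! ### Existence and density of universal tuples. -/

theorem exists_isUniversalTuple (hU : IsRationalUrysohn U) (n : ℕ) :
    ∃ g : Fin n → U ≃ᵢ U, IsUniversalTuple g := by
  induction n with
  | zero => exact ⟨Fin.elim0, isUniversalTuple_zero _⟩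
  | succ n ih =>
    obtain ⟨g, hg⟩ := ih
    obtain ⟨f, -, hf⟩ := hg.exists_snoc hU (Y := ∅) (f := id) ⟨by simp, by simp, by simp⟩
    exact ⟨_, hf⟩

/-- Every commuting tuple agrees with a universal one on any given finite set. -/
theorem exists_isUniversalTuple_eqOn (hU : IsRationalUrysohn U) {n : ℕ} {g : Fin n → U ≃ᵢ U}
    (hg : ∀ i j, g i * g j = g j * g i) (A : Finset U) :
    ∃ g' : Fin n → U ≃ᵢ U, IsUniversalTuple g' ∧ ∀ i, ∀ a ∈ A, g' i a = g i a := by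
  obtain ⟨T, p, hT, hAT, hp⟩ := exists_isFinAct_of_commute hU g hg A
  obtain ⟨u, hu⟩ := exists_isUniversalTuple hU n
  -- A universal tuple contains a copy of every finite system; conjugating by `h⁻¹` moves the copy
  -- onto `T` itself.
  obtain ⟨h, -, hh⟩ := hu.extend ∅ T p (Finset.empty_subset T) hT (by simp)
  refine ⟨_, hu.conj h.symm, fun i a ha => ?_⟩
  change h.symm (u i (h a)) = g i a
  rw [hh i a (hAT ha), h.symm_apply_apply, hp i a ha]

/-- Density inside the centraliser. The finite approximation of `(g, f)` is realized over `B ∪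
f(B)`, which is `g`-invariant because `f` commutes with `g`. Fixing both `a` and `f a` keeps the
value at `a`. -/
theorem IsUniversalTuple.exists_snoc_eqOn (hU : IsRationalUrysohn U) {n : ℕ}
    {g : Fin n → U ≃ᵢ U} (hg : IsUniversalTuple g) {f : U ≃ᵢ U} (hf : ∀ i, g i * f = f * g i)
    (A : Finset U) :
    ∃ f' : U ≃ᵢ U, (∀ a ∈ A, f' a = f a) ∧
      IsUniversalTuple (Fin.snoc g f' : Fin (n + 1) → U ≃ᵢ U) := by
  classical
  obtain ⟨B, hAB, hB⟩ := hg.exists_invariant A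
  have hfB : ∀ i, ∀ b ∈ B ∪ B.image f, g i b ∈ B ∪ B.image f := by
    intro i b hb
    rcases Finset.mem_union.1 hb with hb | hb
    · exact Finset.mem_union_left _ (hB i b hb)
    · obtain ⟨c, hc, rfl⟩ := Finset.mem_image.1 hb
      exact Finset.mem_union_right _ (Finset.mem_image.2
        ⟨g i c, hB i c hc, (DFunLike.congr_fun (hf i) c).symm⟩)
  obtain ⟨T, p, hT, hBT, hp⟩ := exists_isFinAct_of_commute hU
    (Fin.snoc g f : Fin (n + 1) → U ≃ᵢ U) (by
      intro i j
      refine Fin.lastCases ?_ (fun i => ?_) i <;> refine Fin.lastCases ?_ (fun j => ?_) j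
      · rfl
      · rw [Fin.snoc_last, Fin.snoc_castSucc, hf]
      · rw [Fin.snoc_last, Fin.snoc_castSucc, hf]
      · rw [Fin.snoc_castSucc, Fin.snoc_castSucc, hg.comm]) (B ∪ B.image f)
  obtain ⟨h, hhB, χ, hχ, hχp⟩ := hg.exists_snoc_of_extension hT hBT fun i a ha => by
    rw [hp _ a ha, Fin.snoc_castSucc]
    exact ⟨rfl, hfB i a ha⟩
  obtain ⟨f', hf'χ, hf'⟩ := hg.exists_snoc hU hχ
  refine ⟨f', fun a ha => ?_, hf'⟩
  have ha' : a ∈ B ∪ B.image f := Finset.mem_union_left _ (hAB ha)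
  have h1 := hχp (Fin.last n) a (hBT ha')
  rw [hp _ a ha', Fin.snoc_last, Fin.snoc_last, hhB a ha',
    hhB _ (Finset.mem_union_right _ (Finset.mem_image_of_mem _ (hAB ha)))] at h1
  rw [hf'χ a (Finset.mem_image.2 ⟨a, hBT ha', hhB a ha'⟩), h1]

/-! ### Topology: Gδ conditions, comeagreness and the Baire property. -/

theorem isOpen_apply_eq (a b : U) : IsOpen {g : U ≃ᵢ U | g a = b} := by
  rcases Set.eq_empty_or_nonempty {g : U ≃ᵢ U | g a = b} with h | ⟨f, hf⟩
  · rw [h]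
    exact isOpen_empty
  · refine TopologicalSpace.isOpen_generateFrom_of_mem ⟨f, {a}, ?_⟩
    ext g
    simp [show f a = b from hf]

theorem exists_finset_of_isOpen {V : Set (U ≃ᵢ U)} (hV : IsOpen V) {f : U ≃ᵢ U} (hf : f ∈ V) :
    ∃ A : Finset U, ∀ g : U ≃ᵢ U, (∀ a ∈ A, g a = f a) → g ∈ V := by
  classical
  induction hV with
  | basic V hV =>
    obtain ⟨f', A, rfl⟩ := hV
    exact ⟨A, fun g hg a ha => (hg a ha).trans (hf a ha)⟩
  | univ => exact ⟨∅, fun _ _ => trivial⟩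
  | inter V W _ _ h1 h2 =>
    obtain ⟨A, hA⟩ := h1 hf.1
    obtain ⟨B, hB⟩ := h2 hf.2
    exact ⟨A ∪ B, fun g hg => ⟨hA g fun a ha => hg a (Finset.mem_union_left _ ha),
      hB g fun a ha => hg a (Finset.mem_union_right _ ha)⟩⟩
  | sUnion S _ h =>
    obtain ⟨V, hV, hfV⟩ := hf
    obtain ⟨A, hA⟩ := h V hV hfV
    exact ⟨A, fun g hg => ⟨V, hV, hA g hg⟩⟩

theorem exists_finset_of_isOpen_pi {n : ℕ} {V : Set (Fin n → U ≃ᵢ U)} (hV : IsOpen V)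
    {f : Fin n → U ≃ᵢ U} (hf : f ∈ V) :
    ∃ A : Finset U, ∀ g : Fin n → U ≃ᵢ U, (∀ i, ∀ a ∈ A, g i a = f i a) → g ∈ V := by
  classical
  obtain ⟨u, hu, hV⟩ := isOpen_pi_iff'.1 hV f hf
  choose A hA using fun i => exists_finset_of_isOpen (hu i).1 (hu i).2
  exact ⟨Finset.univ.biUnion A, fun g hg => hV fun i _ => hA i _ fun a ha =>
    hg i a (Finset.mem_biUnion.2 ⟨i, Finset.mem_univ i, ha⟩)⟩

theorem isOpen_eqOn {n : ℕ} (f : Fin n → U ≃ᵢ U) (A : Finset U) :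
    IsOpen {g : Fin n → U ≃ᵢ U | ∀ i, ∀ a ∈ A, g i a = f i a} := by
  have : {g : Fin n → U ≃ᵢ U | ∀ i, ∀ a ∈ A, g i a = f i a} =
      ⋂ i, ⋂ a ∈ A, (fun g => g i) ⁻¹' {g : U ≃ᵢ U | g a = f i a} := by
    ext g
    simp
  rw [this]
  exact isOpen_iInter_of_finite fun i => isOpen_biInter_finset fun a _ =>
    (isOpen_apply_eq a _).preimage (continuous_apply i)

theorem isOpen_pi_of_exists_finset {n : ℕ} {V : Set (Fin n → U ≃ᵢ U)}
    (h : ∀ f ∈ V, ∃ A : Finset U, ∀ g : Fin n → U ≃ᵢ U, (∀ i, ∀ a ∈ A, g i a = f i a) → g ∈ V) :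
    IsOpen V :=
  isOpen_iff_forall_mem_open.2 fun f hf => by
    obtain ⟨A, hA⟩ := h f hf
    exact ⟨_, hA, isOpen_eqOn f A, fun _ _ _ => rfl⟩

/-- Each requirement, and each failure of its hypotheses, is witnessed on a finite set and so is
open. Commutation is left out of `S`, so that `S` can be pulled back both to commuting tuples and to
centralisers. -/
theorem exists_isGδ_isUniversalTuple [Countable U] (n : ℕ) :
    ∃ S : Set (Fin n → U ≃ᵢ U), IsGδ S ∧
      ∀ g, (∀ i j, g i * g j = g j * g i) → (IsUniversalTuple g ↔ g ∈ S) := by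
  classical
  let ι := Σ T : Finset U, Finset U × (Fin n → T → U)
  let P : ∀ k : ι, Fin n → U → U := fun k i x => if h : x ∈ k.1 then k.2.2 i ⟨x, h⟩ else x
  let O₁ : U → Set (Fin n → U ≃ᵢ U) := fun x =>
    {g | ∃ T : Finset U, x ∈ T ∧ ∀ i, ∀ t ∈ T, g i t ∈ T}
  let O₂ : ι → Set (Fin n → U ≃ᵢ U) := fun k =>
    {g | k.2.1 ⊆ k.1 → IsFinAct k.1 (P k) → (∀ i, ∀ a ∈ k.2.1, P k i a = g i a ∧ P k i a ∈ k.2.1) →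
      ∃ h : U ≃ᵢ U, (∀ a ∈ k.2.1, h a = a) ∧ ∀ i, ∀ t ∈ k.1, g i (h t) = h (P k i t)}
  have hO₁ : ∀ x, IsOpen (O₁ x) := fun x => isOpen_pi_of_exists_finset <| by
    rintro g ⟨T, hxT, hT⟩
    exact ⟨T, fun g' hg' => ⟨T, hxT, fun i t ht => by rw [hg' i t ht]; exact hT i t ht⟩⟩
  have hO₂ : ∀ k, IsOpen (O₂ k) := fun k => isOpen_pi_of_exists_finset <| by
    intro g hg
    by_cases hk : k.2.1 ⊆ k.1 ∧ IsFinAct k.1 (P k) ∧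
      ∀ i, ∀ a ∈ k.2.1, P k i a = g i a ∧ P k i a ∈ k.2.1
    · obtain ⟨h, hh, hhT⟩ := hg hk.1 hk.2.1 hk.2.2
      refine ⟨k.1.image h, fun g' hg' _ _ _ => ⟨h, hh, fun i t ht => ?_⟩⟩
      rw [hg' i _ (Finset.mem_image_of_mem _ ht), hhT i t ht]
    · refine ⟨k.2.1, fun g' hg' h1 h2 h3 => absurd ⟨h1, h2, fun i a ha => ?_⟩ hk⟩
      rw [← hg' i a ha]
      exact h3 i a ha
  refine ⟨(⋂ x, O₁ x) ∩ ⋂ k, O₂ k, (IsGδ.iInter_of_isOpen hO₁).inter (IsGδ.iInter_of_isOpen hO₂),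
    fun g hg => ⟨fun h => ⟨?_, ?_⟩, fun h => ⟨hg, ?_, ?_⟩⟩⟩
  · exact Set.mem_iInter.2 h.exists_invariant_mem
  · exact Set.mem_iInter.2 fun k h1 h2 h3 => h.extend _ _ _ h1 h2 fun i a ha => h3 i a ha
  · exact Set.mem_iInter.1 h.1
  · intro F T p hFT hT hF
    have hP : ∀ i, ∀ t ∈ T, P ⟨T, F, fun i t => p i t⟩ i t = p i t := fun i t ht => dif_pos ht
    obtain ⟨h', hh, hhT⟩ := Set.mem_iInter.1 h.2 ⟨T, F, fun i t => p i t⟩ hFT (hT.congr hP)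
      fun i a ha => by
        rw [hP i a (hFT ha)]
        exact hF i a ha
    refine ⟨h', hh, fun i t ht => ?_⟩
    rw [← hP i t ht]
    exact hhT i t ht

theorem isUniversalTuple_mem_residual (hU : IsRationalUrysohn U) (n : ℕ) :
    {g : CommutingTuples (U ≃ᵢ U) n | IsUniversalTuple g.1} ∈
      residual (CommutingTuples (U ≃ᵢ U) n) := by
  have := hU.countable
  obtain ⟨S, hS, hSg⟩ := exists_isGδ_isUniversalTuple (U := U) n
  have heq : {g : CommutingTuples (U ≃ᵢ U) n | IsUniversalTuple g.1} = Subtype.val ⁻¹' S :=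
    Set.ext fun g => hSg g.1 g.2
  refine residual_of_dense_Gδ ?_ ?_
  · rw [heq]
    exact hS.preimage continuous_subtype_val
  · rw [dense_iff_inter_open]
    rintro _ ⟨V, hV, rfl⟩ ⟨g, hg⟩
    obtain ⟨A, hA⟩ := exists_finset_of_isOpen_pi hV hg
    obtain ⟨g', hg', h⟩ := exists_isUniversalTuple_eqOn hU g.2 A
    exact ⟨⟨g', hg'.comm⟩, hA g' h, hg'⟩

theorem IsUniversalTuple.snoc_mem_residual (hU : IsRationalUrysohn U) {n : ℕ}
    {g : Fin n → U ≃ᵢ U} (hg : IsUniversalTuple g) :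
    {f : Subgroup.centralizer (Set.range g) |
      IsUniversalTuple (Fin.snoc g (f : U ≃ᵢ U) : Fin (n + 1) → U ≃ᵢ U)} ∈
        residual (Subgroup.centralizer (Set.range g)) := by
  have := hU.countable
  have hcomm : ∀ (f : Subgroup.centralizer (Set.range g)) i, g i * f = f * g i := fun f i =>
    Subgroup.mem_centralizer_iff.1 f.2 _ ⟨i, rfl⟩
  obtain ⟨S, hS, hSg⟩ := exists_isGδ_isUniversalTuple (U := U) (n + 1)
  have heq : {f : Subgroup.centralizer (Set.range g) |
      IsUniversalTuple (Fin.snoc g (f : U ≃ᵢ U) : Fin (n + 1) → U ≃ᵢ U)} =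
      (fun f : Subgroup.centralizer (Set.range g) =>
        (Fin.snoc g (f : U ≃ᵢ U) : Fin (n + 1) → U ≃ᵢ U)) ⁻¹' S := by
    ext f
    refine hSg _ fun i j => ?_
    refine Fin.lastCases ?_ (fun i => ?_) i <;> refine Fin.lastCases ?_ (fun j => ?_) j
    · rfl
    · rw [Fin.snoc_last, Fin.snoc_castSucc, hcomm]
    · rw [Fin.snoc_last, Fin.snoc_castSucc, hcomm]
    · rw [Fin.snoc_castSucc, Fin.snoc_castSucc, hg.comm]
  refine residual_of_dense_Gδ ?_ ?_
  · rw [heq]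
    refine hS.preimage (continuous_pi fun i => ?_)
    refine Fin.lastCases ?_ (fun i => ?_) i
    · simpa only [Fin.snoc_last] using continuous_subtype_val
    · simpa only [Fin.snoc_castSucc] using continuous_const
  · rw [dense_iff_inter_open]
    rintro _ ⟨V, hV, rfl⟩ ⟨f, hf⟩
    obtain ⟨A, hA⟩ := exists_finset_of_isOpen hV hf
    obtain ⟨f', h, hf'⟩ := hg.exists_snoc_eqOn hU (hcomm f) A
    refine ⟨⟨f', Subgroup.mem_centralizer_iff.2 ?_⟩, hA f' h, hf'⟩
    rintro _ ⟨i, rfl⟩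
    simpa only [Fin.snoc_last, Fin.snoc_castSucc] using hf'.comm (Fin.castSucc i) (Fin.last n)

/-- Recording inverses along with values makes the image closed: a pointwise limit of bijections
need not be onto. The coding `e` replaces the metric topology of `U` by a discrete one. -/
theorem isClosedEmbedding_commutingTuples {n : ℕ} {e : U → ℕ} (he : Function.Injective e) :
    IsClosedEmbedding fun (g : CommutingTuples (U ≃ᵢ U) n) (i : Fin n) (x : U) =>
      (e (g.1 i x), e ((g.1 i).symm x)) := by
  classical
  set ev := fun (g : CommutingTuples (U ≃ᵢ U) n) (i : Fin n) (x : U) =>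
      (e (g.1 i x), e ((g.1 i).symm x)) with hev
  have hopen : ∀ (w : Fin n → U → ℕ × ℕ) (A : Finset U),
      {w' : Fin n → U → ℕ × ℕ | ∀ i, ∀ a ∈ A, w' i a = w i a} ∈ 𝓝 w := by
    intro w A
    have : {w' : Fin n → U → ℕ × ℕ | ∀ i, ∀ a ∈ A, w' i a = w i a} =
        ⋂ i, ⋂ a ∈ A, (fun w' => w' i a) ⁻¹' {w i a} := by
      ext w'
      simp
    rw [this]
    refine IsOpen.mem_nhds (isOpen_iInter_of_finite fun i => isOpen_biInter_finset fun a _ =>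
      (isOpen_discrete _).preimage (continuous_apply_apply i a)) (by simp)
  have hcont : Continuous ev := by
    have h : ∀ F : (U ≃ᵢ U) → U, (∀ b, IsOpen {g | F g = b}) → Continuous fun g => e (F g) := by
      refine fun F hF => continuous_discrete_rng.2 fun k => ?_
      have : (fun g => e (F g)) ⁻¹' {k} = ⋃ b ∈ e ⁻¹' {k}, {g | F g = b} := by
        ext g
        simp
      rw [this]
      exact isOpen_biUnion fun b _ => hF b
    refine continuous_pi fun i => continuous_pi fun x => ?_
    have hi : Continuous fun g : CommutingTuples (U ≃ᵢ U) n => g.1 i :=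
      (continuous_apply i).comp continuous_subtype_val
    refine ((h (fun g => g x) fun b => isOpen_apply_eq x b).comp hi).prodMk
      ((h (fun g => g.symm x) fun b => ?_).comp hi)
    convert isOpen_apply_eq b x using 1
    ext g
    exact g.symm_apply_eq.trans eq_comm
  refine ⟨⟨isInducing_iff_nhds.2 fun g => le_antisymm (hcont.tendsto g).le_comap ?_, ?_⟩, ?_⟩
  · intro V hV
    obtain ⟨V', hV', hVo, hgV⟩ := mem_nhds_iff.1 hV
    obtain ⟨W, hW, rfl⟩ := hVo
    obtain ⟨A, hA⟩ := exists_finset_of_isOpen_pi hW hgV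
    refine ⟨_, hopen (ev g) A, fun g' hg' => hV' (hA g'.1 fun i a ha => he ?_)⟩
    exact congrArg Prod.fst (hg' i a ha)
  · intro g g' h
    refine Subtype.ext (funext fun i => IsometryEquiv.ext fun x => he ?_)
    exact congrArg Prod.fst (congrFun (congrFun h i) x)
  · refine isClosed_of_closure_subset fun w hw => ?_
    have key : ∀ A : Finset U, ∃ g : CommutingTuples (U ≃ᵢ U) n, ∀ i, ∀ a ∈ A, ev g i a = w i a := by
      intro A
      obtain ⟨_, h, g, rfl⟩ := mem_closure_iff_nhds.1 hw _ (hopen w A)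
      exact ⟨g, h⟩
    have h1 : ∀ i x, ∃ y, e y = (w i x).1 := fun i x => by
      obtain ⟨g, hg⟩ := key {x}
      exact ⟨g.1 i x, by rw [← hg i x (by simp)]⟩
    have h2 : ∀ i x, ∃ y, e y = (w i x).2 := fun i x => by
      obtain ⟨g, hg⟩ := key {x}
      exact ⟨(g.1 i).symm x, by rw [← hg i x (by simp)]⟩
    choose f hf using h1
    choose b hb using h2
    have key' : ∀ A : Finset U, ∃ g : CommutingTuples (U ≃ᵢ U) n,
        ∀ i, ∀ a ∈ A, g.1 i a = f i a ∧ (g.1 i).symm a = b i a := by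
      intro A
      obtain ⟨g, hg⟩ := key A
      exact ⟨g, fun i a ha => ⟨he (by rw [hf, ← hg i a ha]), he (by rw [hb, ← hg i a ha])⟩⟩
    have hfb : ∀ i x, f i (b i x) = x := fun i x => by
      obtain ⟨g, hg⟩ := key' {x, b i x}
      rw [← (hg i (b i x) (by simp)).1, ← (hg i x (by simp)).2, IsometryEquiv.apply_symm_apply]
    have hfd : ∀ i x y, dist (f i x) (f i y) = dist x y := fun i x y => by
      obtain ⟨g, hg⟩ := key' {x, y}
      rw [← (hg i x (by simp)).1, ← (hg i y (by simp)).1, IsometryEquiv.dist_eq]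
    refine ⟨⟨fun i => IsometryEquiv.mk' (f i) (b i) (hfb i) (Isometry.of_dist_eq (hfd i)),
      fun i j => IsometryEquiv.ext fun x => ?_⟩, ?_⟩
    · change f i (f j x) = f j (f i x)
      obtain ⟨g, hg⟩ := key' {x, f i x, f j x}
      rw [← (hg i (f j x) (by simp)).1, ← (hg j (f i x) (by simp)).1, ← (hg i x (by simp)).1,
        ← (hg j x (by simp)).1]
      exact DFunLike.congr_fun (g.2 i j) x
    · funext i x
      exact Prod.ext (hf i x) (hb i x)

theorem baireSpace_commutingTuples [Countable U] (n : ℕ) :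
    BaireSpace (CommutingTuples (U ≃ᵢ U) n) := by
  obtain ⟨e, he⟩ := exists_injective_nat U
  have := (isClosedEmbedding_commutingTuples (n := n) he).polishSpace
  infer_instance

/-! ### Generic means universal, and the theorem. -/

theorem IsUniversalTuple.isGenericCommutingTuple (hU : IsRationalUrysohn U) {n : ℕ}
    {g : Fin n → U ≃ᵢ U} (hg : IsUniversalTuple g) : IsGenericCommutingTuple g :=
  ⟨hg.comm, Filter.mem_of_superset (isUniversalTuple_mem_residual hU n) fun _ h =>
    hg.exists_conj_eq hU h⟩

/-- In a nonempty Baire space the comeagre orbit of `g` meets the comeagre set of universal tuples,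
and universality passes along conjugation. -/
theorem _root_.IsGenericCommutingTuple.isUniversalTuple (hU : IsRationalUrysohn U) {n : ℕ}
    {g : Fin n → U ≃ᵢ U} (hg : IsGenericCommutingTuple g) : IsUniversalTuple g := by
  have := hU.countable
  have := baireSpace_commutingTuples (U := U) n
  have : Nonempty (CommutingTuples (U ≃ᵢ U) n) := ⟨⟨g, hg.1⟩⟩
  obtain ⟨h, ⟨k, hk⟩, hh⟩ := (dense_of_mem_residual (Filter.inter_mem hg.2
    (isUniversalTuple_mem_residual hU n))).nonempty
  have h1 := IsUniversalTuple.conj (g := h.1) hh k⁻¹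
  convert h1 using 1
  funext i
  rw [← hk i]
  group

end RationalUrysohn

theorem mainTheorem4 {U : Type*} [MetricSpace U] (hU : IsRationalUrysohn U) (n : ℕ) :
    (∃ g : Fin n → U ≃ᵢ U, IsGenericCommutingTuple g) ∧
    ∀ g : Fin n → U ≃ᵢ U, IsGenericCommutingTuple g →
      {f : Subgroup.centralizer (Set.range g) |
          IsGenericCommutingTuple (Fin.snoc g (f : U ≃ᵢ U) : Fin (n + 1) → U ≃ᵢ U)} ∈
        residual (Subgroup.centralizer (Set.range g)) ∧
      ∃ f : Subgroup.centralizer (Set.range g),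
        conjugatesOf f ∈ residual (Subgroup.centralizer (Set.range g)) := by
  refine ⟨?_, fun g hg => ?_⟩
  · obtain ⟨g, hg⟩ := RationalUrysohn.exists_isUniversalTuple hU n
    exact ⟨g, hg.isGenericCommutingTuple hU⟩
  have hg' := hg.isUniversalTuple hU
  have hres := hg'.snoc_mem_residual hU
  refine ⟨Filter.mem_of_superset hres fun f hf => hf.isGenericCommutingTuple hU, ?_⟩
  obtain ⟨f, -, hf⟩ := hg'.exists_snoc hU (Y := ∅) (f := id) ⟨by simp, by simp, by simp⟩
  refine ⟨⟨f, Subgroup.mem_centralizer_iff.2 ?_⟩, Filter.mem_of_superset hres fun f' hf' => ?_⟩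
  · rintro _ ⟨i, rfl⟩
    simpa only [Fin.snoc_last, Fin.snoc_castSucc] using hf.comm (Fin.castSucc i) (Fin.last n)
  -- Both tuples begin with `g`, so the first `n` equations say that `k` centralises `g`, and the
  -- last one that `k` conjugates `f` to `f'`.
  · obtain ⟨k, hk⟩ := hf.exists_conj_eq hU hf'
    refine isConj_iff.2 ⟨⟨k, Subgroup.mem_centralizer_iff.2 ?_⟩, Subtype.ext ?_⟩
    · rintro _ ⟨i, rfl⟩
      have h := hk (Fin.castSucc i)
      rw [Fin.snoc_castSucc, Fin.snoc_castSucc, mul_inv_eq_iff_eq_mul] at h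
      exact h.symm
    · have h := hk (Fin.last n)
      rw [Fin.snoc_last, Fin.snoc_last] at h
      exact h
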